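/- **Setting.** Let $n\ge 2$ and let $\bar M=M\cup\partial M$ be a compact complex manifold of complex dimension $n$ with complex structure $J$ and $C^2$ boundary (that is, $\bar M$ has holomorphic charts up to the boundary, with values in closed sides of $C^2$ real hypersurfaces of $\mathbb C^n$, whose coordinate changes are holomorphic and smooth up to the boundary). Suppose that $\partial M$ is Levi flat: the Levi form $\sum\rho_{i\bar j}\xi_i\bar\xi_j$ of a local $C^2$ defining function $\rho$ vanishes on the $(1,0)$-vectors tangent to $\partial M$. Let $\omega=\sqrt{-1}g_{i\bar j}dz^i\wedge d\bar z^j$ be the Kähler form of a smooth Hermitian metric on $\bar M$, with metric tensor $g(X,Y)=\omega(X,JY)$ extended complex bilinearly, and let $\chi=\sqrt{-1}\chi_{i\bar j}dz^i\wedge d\bar z^j$ be a smooth real $(1,1)$-form on $\bar M$. For a real function $u$ put $\mathfrak g[u]=\chi+\sqrt{-1}\partial\bar\partial u$, and let $\lambda(\mathfrak g[u])=(\lambda_1,\dots,\lambda_n)$ be its eigenvalues with respect to $\omega$. Let $\Gamma\subset\mathbb R^n$ be an open symmetric convex cone with vertex at the origin, $\partial\Gamma\ne\emptyset$ and $\Gamma_n\subseteq\Gamma\subseteq\Gamma_1$,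 where $\Gamma_n=\{\lambda:\text{ all }\lambda_i>0\}$ and $\Gamma_1=\{\lambda:\sum_i\lambda_i>0\}$. Let $f$ be a smooth symmetric concave function on $\Gamma$ with $\partial f/\partial\lambda_i>0$ for all $i$. Let $\mathcal K\subset\Gamma$ be compact. **Proposition.** There is a constant $C>0$, depending only on $(\bar M,J,\omega)$, $\chi$, $\Gamma$, $f$ and $\mathcal K$, such that the following holds. Let $\psi\in C^0(\bar M)$ satisfy $$\delta_{\psi,f}:=\inf_{\bar M}\psi-\sup_{\lambda_0\in\partial\Gamma}\limsup_{\lambda\to\lambda_0}f(\lambda)>0,$$ and let $\varphi$ be a real function on $\partial M$. Let $\underline u\in C^2(\bar M)$ be an admissible subsolution with eigenvalues in $\mathcal K$: $$\lambda(\mathfrak g[\underline u])\in\mathcal K \text{ (in some order) on }\bar M,\qquad f(\lambda(\mathfrak g[\underline u]))\ge\psi\text{ in }M,\qquad \underline u=\varphi\text{ on }\partial M.$$ Let $u\in C^3(M)\cap C^2(\bar M)$ be an admissible solution of the Dirichlet problem: $$\lambda(\mathfrak g[u])\in\Gamma\text{ and } f(\lambda(\mathfrak g[u]))=\psi\text{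 in }M,\qquad u=\varphi\text{ on }\partial M.$$ Let $p_0\in\partial M$, let $\nu$ be the unit inner normal vector of $\partial M$ at $p_0$, and put $\xi_n=\frac12(\nu-\sqrt{-1}J\nu)$. Let $\xi_1,\dots,\xi_{n-1}$ be complexified tangent vectors at $p_0$ lying in $T_{\partial M}\cap JT_{\partial M}$, with $J\xi_\alpha=\sqrt{-1}\,\xi_\alpha$ and $g(\xi_\alpha,\bar\xi_\beta)=\delta_{\alpha\beta}$. Then, with $\mathfrak g=\mathfrak g[u]$, $$\mathfrak g(\xi_n,J\bar\xi_n)(p_0)\le C\Big(1+\sum_{\alpha=1}^{n-1}\big|\mathfrak g(\xi_\alpha,J\bar\xi_n)(p_0)\big|^2\Big).$$ In particular $C$ does not depend on $\psi$, $\varphi$, $u$ (hence not on $\sup_M|\nabla u|$ nor on $\delta_{\psi,f}^{-1}$), and it depends on $\underline u$ only through the compact set $\mathcal K$. For a fixed $\underline u$ one may take $\mathcal K$ to be the (compact) set of all orderings of $\lambda(\mathfrak g[\underline u])$ at the points of $\bar M$; more generally, a bound for $|\underline u|_{C^2(\bar M)}$ together with a lower bound for the distance of $\lambda(\mathfrak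 g[\underline u])$ to $\partial\Gamma$ provides such a $\mathcal K$. -/

import Mathlib

open Set Filter Topology
open scoped ContDiff ComplexOrder

noncomputable section

namespace LeviFlatDirichlet

/-- Complex coordinate space. A real vector `∑ (xᵢ ∂/∂xᵢ + yᵢ ∂/∂yᵢ)` is identified with the point
`(xᵢ + √-1 yᵢ)ᵢ`. -/
abbrev CSpace (n : ℕ) : Type := Fin n → ℂ

/-! ### Manifolds with boundary -/

/-- `ρ` is a `C²` defining function of `S` near `z`: near `z` the set `S` is `{ρ ≤ 0}`, and `dρ` does
not vanish on `{ρ = 0}`. (Near an interior point of `S` the function `ρ = -1` will do.) -/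
def IsLocalDefiningFunction {n : ℕ} (S : Set (CSpace n)) (z : CSpace n) (ρ : CSpace n → ℝ) : Prop :=
  ∃ V : Set (CSpace n), IsOpen V ∧ z ∈ V ∧ ContDiffOn ℝ 2 ρ V ∧ S ∩ V = {w ∈ V | ρ w ≤ 0} ∧
    ∀ w ∈ V, ρ w = 0 → fderiv ℝ ρ w ≠ 0

/-- A complex manifold `M̄ = M ∪ ∂M` of complex dimension `n` with `C²` boundary, given by an atlas of
holomorphic charts up to the boundary: each chart is a homeomorphism from an open subset of `M̄` onto
a subset of `ℂⁿ` which is locally open or one closed side of a `C²` real hypersurface; the changes of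
coordinates are holomorphic, and smooth up to the boundary. -/
structure ComplexManifoldWithBoundary (n : ℕ) (M : Type*) [TopologicalSpace M] where
  atlas : Set (PartialEquiv M (CSpace n))
  cover : ∀ p : M, ∃ e ∈ atlas, p ∈ e.source
  isOpen_source : ∀ e ∈ atlas, IsOpen e.source
  continuousOn_coord : ∀ e ∈ atlas, ContinuousOn e e.source
  continuousOn_symm : ∀ e ∈ atlas, ContinuousOn e.symm e.target
  c2_boundary : ∀ e ∈ atlas, ∀ z ∈ e.target, ∃ ρ, IsLocalDefiningFunction e.target z ρ
  holomorphic : ∀ e ∈ atlas, ∀ e' ∈ atlas,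
    ContDiffOn ℂ ∞ (e' ∘ e.symm) (e.symm.trans e').source

/-! ### Complexified tangent vectors in a chart -/

/-- Complexified tangent vectors in a chart: `(a, b)` is `∑ aᵢ ∂/∂zᵢ + ∑ bᵢ ∂/∂z̄ᵢ`. -/
abbrev CTangent (n : ℕ) : Type := CSpace n × CSpace n

/-- The complex structure `J`, extended `ℂ`-linearly. -/
def J {n : ℕ} (X : CTangent n) : CTangent n := (Complex.I • X.1, -Complex.I • X.2)

/-- Complex conjugation `X ↦ X̄`. -/
def conjVec {n : ℕ} (X : CTangent n) : CTangent n := (star X.2, star X.1)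

/-- A real tangent vector, as a complexified one. -/
def ofReal {n : ℕ} (v : CSpace n) : CTangent n := (v, star v)

/-- The value at `(X, Y)` of the 2-form `√-1 ∑ Gᵢⱼ dzᵢ ∧ dz̄ⱼ`. -/
def form {n : ℕ} (G : Matrix (Fin n) (Fin n) ℂ) (X Y : CTangent n) : ℂ :=
  Complex.I * ∑ i, ∑ j, G i j * (X.1 i * Y.2 j - Y.1 i * X.2 j)

/-- The differential at `z` of a real function, extended `ℂ`-linearly:
`X ↦ ∑ (∂ρ/∂zᵢ) aᵢ + ∑ (∂ρ/∂z̄ᵢ) bᵢ`. -/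
def dC {n : ℕ} (ρ : CSpace n → ℝ) (z : CSpace n) (X : CTangent n) : ℂ :=
  ∑ i, (((fderiv ℝ ρ z (Pi.single i 1) : ℂ)
            - Complex.I * (fderiv ℝ ρ z (Pi.single i Complex.I) : ℂ)) / 2 * X.1 i
      + ((fderiv ℝ ρ z (Pi.single i 1) : ℂ)
            + Complex.I * (fderiv ℝ ρ z (Pi.single i Complex.I) : ℂ)) / 2 * X.2 i)

/-- The second real derivative (up to the boundary of `S`) of `v` at `z` in the directions `a`, `b`. -/
def secondDeriv {n : ℕ} (v : CSpace n → ℝ) (S : Set (CSpace n)) (z a b : CSpace n) : ℝ :=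
  fderivWithin ℝ (fun y => fderivWithin ℝ v S y) S z a b

/-- The complex Hessian `∂²v/∂zᵢ∂z̄ⱼ`, where `∂/∂zᵢ = (∂/∂xᵢ - √-1 ∂/∂yᵢ)/2` and
`∂/∂z̄ⱼ = (∂/∂xⱼ + √-1 ∂/∂yⱼ)/2`. -/
def complexHessian {n : ℕ} (v : CSpace n → ℝ) (S : Set (CSpace n)) (z : CSpace n) :
    Matrix (Fin n) (Fin n) ℂ := Matrix.of fun i j =>
  (((secondDeriv v S z (Pi.single i 1) (Pi.single j 1)
      + secondDeriv v S z (Pi.single i Complex.I) (Pi.single j Complex.I) : ℝ) : ℂ)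
    + Complex.I * ((secondDeriv v S z (Pi.single i 1) (Pi.single j Complex.I)
      - secondDeriv v S z (Pi.single i Complex.I) (Pi.single j 1) : ℝ) : ℂ)) / 4

namespace ComplexManifoldWithBoundary

variable {n : ℕ} {M : Type*} [TopologicalSpace M]

/-- The boundary `∂M`. -/
def boundary (X : ComplexManifoldWithBoundary n M) : Set M :=
  {p | ∃ e ∈ X.atlas, p ∈ e.source ∧ e p ∉ interior e.target}

/-- The interior `M = M̄ \ ∂M`. -/
def inner (X : ComplexManifoldWithBoundary n M) : Set M := X.boundaryᶜ

/-- `u ∈ C^k(M̄)`: of class `C^k` up to the boundary. -/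
def IsCk (X : ComplexManifoldWithBoundary n M) (k : ℕ) (u : M → ℝ) : Prop :=
  ∀ e ∈ X.atlas, ContDiffOn ℝ k (u ∘ e.symm) e.target

/-- `u ∈ C^k(M)`: of class `C^k` in the interior. -/
def IsCkInner (X : ComplexManifoldWithBoundary n M) (k : ℕ) (u : M → ℝ) : Prop :=
  ∀ e ∈ X.atlas, ContDiffOn ℝ k (u ∘ e.symm) (interior e.target)

/-- A smooth real `(1,1)`-form `√-1 ∑ χᵢⱼ dzᵢ ∧ dz̄ⱼ` on `M̄`: a smooth Hermitian matrix of
coefficients in each chart, with the transformation law of a `(1,1)`-form. -/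
structure RealOneOneForm (X : ComplexManifoldWithBoundary n M) where
  coeff : PartialEquiv M (CSpace n) → CSpace n → Matrix (Fin n) (Fin n) ℂ
  isHermitian : ∀ e ∈ X.atlas, ∀ z ∈ e.target, (coeff e z).IsHermitian
  smooth : ∀ e ∈ X.atlas, ∀ i j, ContDiffOn ℝ ∞ (fun z => coeff e z i j) e.target
  transform : ∀ e ∈ X.atlas, ∀ e' ∈ X.atlas, ∀ z ∈ (e.symm.trans e').source, ∀ i j,
    coeff e z i j = ∑ k, ∑ l, coeff e' (e' (e.symm z)) k l
      * fderivWithin ℂ (e' ∘ e.symm) (e.symm.trans e').source z (Pi.single i 1) k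
      * star (fderivWithin ℂ (e' ∘ e.symm) (e.symm.trans e').source z (Pi.single j 1) l)

/-- A Hermitian metric on `M̄`, given by its Kähler form `ω = √-1 ∑ gᵢⱼ dzᵢ ∧ dz̄ⱼ`. -/
structure HermitianMetric (X : ComplexManifoldWithBoundary n M) extends RealOneOneForm X where
  posDef : ∀ e ∈ X.atlas, ∀ z ∈ e.target, (coeff e z).PosDef

/-- The metric tensor `g(X, Y) = ω(X, JY)` at the point with coordinate `z` in the chart `e`, extended
`ℂ`-bilinearly to complexified tangent vectors; `g(∂/∂zᵢ, ∂/∂z̄ⱼ) = gᵢⱼ`. -/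
def HermitianMetric.tensor {X : ComplexManifoldWithBoundary n M} (g : X.HermitianMetric)
    (e : PartialEquiv M (CSpace n)) (z : CSpace n) (Y Z : CTangent n) : ℂ :=
  form (g.coeff e z) Y (J Z)

/-- The coefficients `χᵢⱼ + ∂²u/∂zᵢ∂z̄ⱼ` of `𝔤[u] = χ + √-1 ∂∂̄u` in the chart `e`. -/
def RealOneOneForm.deform {X : ComplexManifoldWithBoundary n M} (χ : X.RealOneOneForm) (u : M → ℝ)
    (e : PartialEquiv M (CSpace n)) (z : CSpace n) : Matrix (Fin n) (Fin n) ℂ :=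
  χ.coeff e z + complexHessian (u ∘ e.symm) e.target z

/-- `l` lists, with multiplicity and in some order, the eigenvalues of `𝔤[u]` with respect to `ω`
at `p`. -/
def IsEigenvalues (X : ComplexManifoldWithBoundary n M) (g : X.HermitianMetric)
    (χ : X.RealOneOneForm) (u : M → ℝ) (p : M) (l : Fin n → ℝ) : Prop :=
  ∀ e ∈ X.atlas, p ∈ e.source →
    ((g.coeff e (e p))⁻¹ * χ.deform u e (e p)).charpoly
      = ∏ i, (Polynomial.X - Polynomial.C (l i : ℂ))

/-- The complexified tangent vector `ξ` at `p ∈ ∂M` lies in `T_{∂M} ∩ J T_{∂M}`. -/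
def InComplexTangent (_X : ComplexManifoldWithBoundary n M) (e : PartialEquiv M (CSpace n)) (p : M)
    (ξ : CTangent n) : Prop :=
  ∃ ρ, IsLocalDefiningFunction e.target (e p) ρ ∧ dC ρ (e p) ξ = 0 ∧ dC ρ (e p) (J ξ) = 0

/-- The boundary is Levi flat: the Levi form `∑ ρᵢⱼ ξᵢ ξ̄ⱼ` of a defining function vanishes on the
vectors of type `(1,0)` tangent to the boundary. -/
def IsLeviFlat (X : ComplexManifoldWithBoundary n M) : Prop :=
  ∀ p ∈ X.boundary, ∀ e ∈ X.atlas, p ∈ e.source →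
    ∃ ρ, IsLocalDefiningFunction e.target (e p) ρ ∧
      ∀ ξ : CTangent n, J ξ = Complex.I • ξ → dC ρ (e p) ξ = 0 →
        form (complexHessian ρ univ (e p)) ξ (J (conjVec ξ)) = 0

/-- The real tangent vector `ν` is the unit inner normal of `∂M` at `p`. -/
def IsUnitInnerNormal (X : ComplexManifoldWithBoundary n M) (g : X.HermitianMetric)
    (e : PartialEquiv M (CSpace n)) (p : M) (ν : CSpace n) : Prop :=
  ∃ ρ, IsLocalDefiningFunction e.target (e p) ρ ∧ fderiv ℝ ρ (e p) ν < 0 ∧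
    (∀ τ : CSpace n, fderiv ℝ ρ (e p) τ = 0 → g.tensor e (e p) (ofReal ν) (ofReal τ) = 0) ∧
    g.tensor e (e p) (ofReal ν) (ofReal ν) = 1

/-! ### The Dirichlet problem -/

/-- `u` is admissible: `λ(𝔤[u]) ∈ Γ` in `M`. -/
def IsAdmissible (X : ComplexManifoldWithBoundary n M) (g : X.HermitianMetric)
    (χ : X.RealOneOneForm) (Γ : Set (Fin n → ℝ)) (u : M → ℝ) : Prop :=
  ∀ p ∈ X.inner, ∃ l ∈ Γ, X.IsEigenvalues g χ u p l

/-- `u ∈ C³(M) ∩ C²(M̄)` is an admissible solution of `f(λ(𝔤[u])) = ψ` in `M`, `u = φ` on `∂M`. -/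
structure IsSolution (X : ComplexManifoldWithBoundary n M) (g : X.HermitianMetric)
    (χ : X.RealOneOneForm) (Γ : Set (Fin n → ℝ)) (f : (Fin n → ℝ) → ℝ) (ψ φ u : M → ℝ) : Prop where
  c3 : X.IsCkInner 3 u
  c2 : X.IsCk 2 u
  admissible : X.IsAdmissible g χ Γ u
  equation : ∀ p ∈ X.inner, ∀ l ∈ Γ, X.IsEigenvalues g χ u p l → f l = ψ p
  boundary_value : ∀ p ∈ X.boundary, u p = φ p

/-- `v ∈ C²(M̄)` is an admissible subsolution: `f(λ(𝔤[v])) ≥ ψ` in `M`, `v = φ` on `∂M`. -/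
structure IsSubsolution (X : ComplexManifoldWithBoundary n M) (g : X.HermitianMetric)
    (χ : X.RealOneOneForm) (Γ : Set (Fin n → ℝ)) (f : (Fin n → ℝ) → ℝ) (ψ φ v : M → ℝ) : Prop where
  c2 : X.IsCk 2 v
  admissible : X.IsAdmissible g χ Γ v
  inequality : ∀ p ∈ X.inner, ∀ l ∈ Γ, X.IsEigenvalues g χ v p l → ψ p ≤ f l
  boundary_value : ∀ p ∈ X.boundary, v p = φ p

end ComplexManifoldWithBoundary

/-! ### The cone and the function -/

/-- `Γ` is an open symmetric convex cone with vertex at the origin and nonempty boundary, and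
`Γₙ ⊆ Γ ⊆ Γ₁`. -/
structure IsSymmetricCone {n : ℕ} (Γ : Set (Fin n → ℝ)) : Prop where
  isOpen : IsOpen Γ
  convex : Convex ℝ Γ
  cone : ∀ l ∈ Γ, ∀ t : ℝ, 0 < t → t • l ∈ Γ
  symmetric : ∀ l ∈ Γ, ∀ s : Equiv.Perm (Fin n), l ∘ s ∈ Γ
  frontier_nonempty : (frontier Γ).Nonempty
  positive_subset : ∀ l : Fin n → ℝ, (∀ i, 0 < l i) → l ∈ Γ
  subset_trace : ∀ l ∈ Γ, 0 < ∑ i, l i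

/-- `f` is smooth and symmetric on `Γ`, with `∂f/∂λᵢ > 0`, and concave. -/
structure IsStructureFunction {n : ℕ} (Γ : Set (Fin n → ℝ)) (f : (Fin n → ℝ) → ℝ) : Prop where
  smooth : ContDiffOn ℝ ∞ f Γ
  symmetric : ∀ l ∈ Γ, ∀ s : Equiv.Perm (Fin n), f (l ∘ s) = f l
  elliptic : ∀ l ∈ Γ, ∀ i, 0 < fderiv ℝ f l (Pi.single i 1)
  concave : ConcaveOn ℝ Γ f

/-- `sup_{∂Γ} f`, the supremum over `λ₀ ∈ ∂Γ` of `limsup_{λ → λ₀} f(λ)`; it may be infinite. -/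
def supFrontier {n : ℕ} (Γ : Set (Fin n → ℝ)) (f : (Fin n → ℝ) → ℝ) : EReal :=
  ⨆ l₀ ∈ frontier Γ, limsup (fun l => (f l : EReal)) (𝓝[Γ] l₀)

/-- `δ_{ψ,f} = inf_{M̄} ψ - sup_{∂Γ} f`. -/
def delta {n : ℕ} {M : Type*} (Γ : Set (Fin n → ℝ)) (f : (Fin n → ℝ) → ℝ) (ψ : M → ℝ) : EReal :=
  (⨅ p, (ψ p : EReal)) - supFrontier Γ f

end LeviFlatDirichlet

end

/-! `u - v` vanishes on `∂M`, so by Levi flatness its complex Hessian vanishes on the complex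
tangent space of the boundary. Hence in a `g`-orthonormal frame `ξ₁, …, ξₙ₋₁, √2 ξₙ` at `p₀` the
matrices of `𝔤[u]` and `𝔤[v]` have the same upper left block. If the last diagonal entry of `𝔤[u]`
were much larger than `1 + ∑ |𝔤(ξ_α, J ξ̄ₙ)|²`, then `λ(𝔤[u])` would strictly dominate a point of
the convex hull of the permutations of `λ(𝔤[v])`. Symmetry, concavity and monotonicity of `f` would
then give `f(λ(𝔤[u])) > f(λ(𝔤[v]))`, whereas `f(λ(𝔤[u])) = ψ ≤ f(λ(𝔤[v]))` in `M` and, by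
continuity, also at `p₀`. -/

namespace LeviFlatDirichlet

section Hypersurface

variable {E : Type*} [NormedAddCommGroup E] [NormedSpace ℝ E]

theorem tendsto_add_smul_nhdsGT (z a : E) :
    Tendsto (fun t : ℝ => z + t • a) (𝓝[>] 0) (𝓝 z) :=
  (Continuous.tendsto' (by fun_prop) 0 z (by simp)).mono_left nhdsWithin_le_nhds

theorem exists_curve_in_zero_set {ρ : E → ℝ} {z a : E} {n : WithTop ℕ∞} (hn : n ≠ 0)
    (hρ : ContDiffAt ℝ n ρ z) (h0 : ρ z = 0) (hne : fderiv ℝ ρ z ≠ 0) (ha : fderiv ℝ ρ z a = 0) :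
    ∃ γ : ℝ → E, ContDiffAt ℝ n γ 0 ∧ γ 0 = z ∧ deriv γ 0 = a ∧ ∀ᶠ t in 𝓝 0, ρ (γ t) = 0 := by
  obtain ⟨N, hN⟩ : ∃ N, fderiv ℝ ρ z N ≠ 0 := by
    contrapose! hne
    exact ContinuousLinearMap.ext hne
  let L : ℝ × ℝ →L[ℝ] E := (ContinuousLinearMap.fst ℝ ℝ ℝ).smulRight a
    + (ContinuousLinearMap.snd ℝ ℝ ℝ).smulRight N
  have hL (t s : ℝ) : L (t, s) = t • a + s • N := rfl
  let P : ℝ × ℝ → E := fun p => z + L p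
  have hP0 : P (0, 0) = z := by simp [P, hL]
  have hF : ContDiffAt ℝ n (ρ ∘ P) (0, 0) := ContDiffAt.comp _ (hP0 ▸ hρ) (by fun_prop)
  have hF' : fderiv ℝ (ρ ∘ P) (0, 0) = (fderiv ℝ ρ z).comp L := by
    have hρ' : HasFDerivAt ρ (fderiv ℝ ρ z) (P (0, 0)) :=
      hP0.symm ▸ (hρ.differentiableAt hn).hasFDerivAt
    exact (hρ'.comp (0, 0) (L.hasFDerivAt.const_add z)).fderiv
  have hinv : (fderiv ℝ (ρ ∘ P) (0, 0) ∘L .inr ℝ ℝ ℝ).IsInvertible :=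
    ⟨ContinuousLinearEquiv.smulLeft (Units.mk0 _ hN), by ext; simp [hF', hL]⟩
  let s : ℝ → ℝ := hF.implicitFunction hn hinv
  have hs0 : s 0 = 0 := hF.implicitFunction_apply_self hn hinv
  have hs : ContDiffAt ℝ n s 0 := hF.contDiffAt_implicitFunction hn hinv
  have hs' : HasDerivAt s 0 0 :=
    (hF.hasStrictFDerivAt_implicitFunction hn hinv).hasFDerivAt.hasDerivAt.congr_deriv (by
      rw [hF']
      simp [hL, ha])
  refine ⟨fun t => P (t, s t), by fun_prop, by simp only [hs0, hP0], HasDerivAt.deriv ?_, ?_⟩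
  · have hd := (L.hasFDerivAt.comp_hasDerivAt 0 ((hasDerivAt_id (0 : ℝ)).prodMk hs')).const_add z
    rwa [hL, one_smul, zero_smul, add_zero] at hd
  · filter_upwards [hF.eventually_apply_implicitFunction hn hinv] with t ht
    exact ht.trans (by rw [Function.comp_apply, hP0, h0])

variable {S : Set E} {h : E → ℝ} {γ : ℝ → E}

theorem fderivWithin_apply_deriv_eq_zero {t : ℝ} (hh : DifferentiableWithinAt ℝ h S (γ t))
    (hγ : DifferentiableAt ℝ γ t) (hS : ∀ᶠ s in 𝓝 t, γ s ∈ S) (h0 : ∀ᶠ s in 𝓝 t, h (γ s) = 0) :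
    fderivWithin ℝ h S (γ t) (deriv γ t) = 0 := by
  have hd : HasDerivAt (h ∘ γ) (fderivWithin ℝ h S (γ t) (deriv γ t)) t :=
    (hh.hasFDerivWithinAt.comp_hasDerivWithinAt t hγ.hasDerivAt.hasDerivWithinAt
      (mapsTo_preimage γ S)).hasDerivAt hS
  exact hd.unique ((hasDerivAt_const t (0 : ℝ)).congr_of_eventuallyEq h0)

theorem fderivWithin_fderivWithin_apply_deriv {t : ℝ}
    (hh : ∀ᶠ s in 𝓝 t, DifferentiableWithinAt ℝ h S (γ s))
    (hh' : DifferentiableWithinAt ℝ (fderivWithin ℝ h S) S (γ t)) (hγ : ContDiffAt ℝ 2 γ t)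
    (hS : ∀ᶠ s in 𝓝 t, γ s ∈ S) (h0 : ∀ᶠ s in 𝓝 t, h (γ s) = 0) :
    fderivWithin ℝ (fderivWithin ℝ h S) S (γ t) (deriv γ t) (deriv γ t)
      = -fderivWithin ℝ h S (γ t) (deriv (deriv γ) t) := by
  have hγ' : ∀ᶠ s in 𝓝 t, DifferentiableAt ℝ γ s :=
    (hγ.eventually (by decide)).mono fun s hs => hs.differentiableAt two_ne_zero
  have hγ'' : DifferentiableAt ℝ (deriv γ) t :=
    (hγ.derivWithin (m := 1) le_rfl).differentiableAt one_ne_zero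
  have hzero : ∀ᶠ s in 𝓝 t, fderivWithin ℝ h S (γ s) (deriv γ s) = 0 := by
    filter_upwards [hh, hγ', hS.eventually_nhds, h0.eventually_nhds] with s hhs hγs hSs h0s
    exact fderivWithin_apply_deriv_eq_zero hhs hγs hSs h0s
  have hd := ((hh'.hasFDerivWithinAt.comp_hasDerivWithinAt t
    hγ'.self_of_nhds.hasDerivAt.hasDerivWithinAt (mapsTo_preimage γ S)).hasDerivAt hS).clm_apply
    hγ''.hasDerivAt
  exact eq_neg_of_add_eq_zero_left
    (hd.unique ((hasDerivAt_const t (0 : ℝ)).congr_of_eventuallyEq hzero))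

theorem exists_eq_smul_of_ker_le_ker {L L' : E →L[ℝ] ℝ} (hL : ∀ a, L a = 0 → L' a = 0) :
    ∃ c : ℝ, L' = c • L := by
  have hspan : (L' : E →ₗ[ℝ] ℝ) ∈ Submodule.span ℝ (range fun _ : Unit => (L : E →ₗ[ℝ] ℝ)) :=
    mem_span_of_iInf_ker_le_ker (by simpa [SetLike.le_def] using hL)
  obtain ⟨c, hc⟩ := Submodule.mem_span_singleton.1 (by rwa [range_const] at hspan)
  exact ⟨c, ContinuousLinearMap.coe_injective hc.symm⟩

/-- A Lagrange multiplier rule of second order: along a curve `γ` in `{ρ = 0}` with velocity `a`,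
both `h''(a, a) + h'(γ'')` and `ρ''(a, a) + ρ'(γ'')` vanish, and `h' = c ρ'`. -/
theorem exists_fderivWithin_fderivWithin_apply_eq_mul {ρ : E → ℝ} {z : E}
    (hS : UniqueDiffOn ℝ S) (hh : ContDiffOn ℝ 2 h S) (hρ : ContDiffAt ℝ 2 ρ z) (hz : ρ z = 0)
    (hne : fderiv ℝ ρ z ≠ 0) (hρS : ∀ᶠ w in 𝓝 z, ρ w = 0 → w ∈ S ∧ h w = 0) :
    ∃ c : ℝ, ∀ a, fderiv ℝ ρ z a = 0 → fderivWithin ℝ (fderivWithin ℝ h S) S z a a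
      = c * fderiv ℝ (fderiv ℝ ρ) z a a := by
  have hcurve (a : E) (ha : fderiv ℝ ρ z a = 0) : ∃ γ : ℝ → E, ContDiffAt ℝ 2 γ 0 ∧ γ 0 = z ∧
      deriv γ 0 = a ∧ (∀ᶠ t in 𝓝 0, ρ (γ t) = 0) ∧ (∀ᶠ t in 𝓝 0, γ t ∈ S) ∧
      ∀ᶠ t in 𝓝 0, h (γ t) = 0 := by
    obtain ⟨γ, hγ, rfl, hγa, hργ⟩ := exists_curve_in_zero_set two_ne_zero hρ hz hne ha
    have hev := (hγ.continuousAt.eventually hρS).and hργ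
    exact ⟨γ, hγ, rfl, hγa, hργ, hev.mono fun t ht => (ht.1 ht.2).1,
      hev.mono fun t ht => (ht.1 ht.2).2⟩
  have hhd : DifferentiableOn ℝ h S := hh.differentiableOn two_ne_zero
  obtain ⟨c, hc⟩ : ∃ c : ℝ, fderivWithin ℝ h S z = c • fderiv ℝ ρ z :=
    exists_eq_smul_of_ker_le_ker fun a ha => by
      obtain ⟨γ, hγ, rfl, rfl, -, hγS, hhγ⟩ := hcurve a ha
      exact fderivWithin_apply_deriv_eq_zero (hhd _ hγS.self_of_nhds)
        (hγ.differentiableAt two_ne_zero) hγS hhγ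
  refine ⟨c, fun a ha => ?_⟩
  obtain ⟨γ, hγ, rfl, rfl, hργ, hγS, hhγ⟩ := hcurve a ha
  have hρd : ∀ᶠ t in 𝓝 0, DifferentiableAt ℝ ρ (γ t) := hγ.continuousAt.eventually
    ((hρ.eventually (by decide)).mono fun w hw => hw.differentiableAt two_ne_zero)
  have hρ' : DifferentiableAt ℝ (fderiv ℝ ρ) (γ 0) :=
    (hρ.fderiv_right (m := 1) le_rfl).differentiableAt one_ne_zero
  have hh'' := fderivWithin_fderivWithin_apply_deriv (hγS.mono fun t ht => hhd _ ht)
    ((hh.fderivWithin hS (m := 1) le_rfl).differentiableOn one_ne_zero _ hγS.self_of_nhds)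
    hγ hγS hhγ
  have hρ'' := fderivWithin_fderivWithin_apply_deriv (S := univ)
    (hρd.mono fun t ht => ht.differentiableWithinAt)
    (by simpa only [fderivWithin_univ] using hρ'.differentiableWithinAt)
    hγ (.of_forall fun t => mem_univ _) hργ
  simp only [fderivWithin_univ] at hρ''
  rw [hh'', hρ'', hc, smul_apply, smul_eq_mul, mul_neg]

end Hypersurface

namespace IsLocalDefiningFunction

variable {n : ℕ} {S : Set (CSpace n)} {z : CSpace n} {ρ ρ₁ ρ₂ : CSpace n → ℝ}

theorem contDiffAt (h : IsLocalDefiningFunction S z ρ) : ContDiffAt ℝ 2 ρ z := by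
  obtain ⟨V, hV, hz, hρ, -, -⟩ := h
  exact hρ.contDiffAt (hV.mem_nhds hz)

theorem differentiableAt (h : IsLocalDefiningFunction S z ρ) : DifferentiableAt ℝ ρ z :=
  h.contDiffAt.differentiableAt two_ne_zero

theorem fderiv_ne_zero (h : IsLocalDefiningFunction S z ρ) (h0 : ρ z = 0) : fderiv ℝ ρ z ≠ 0 := by
  obtain ⟨V, -, hz, -, -, hd⟩ := h
  exact hd z hz h0

theorem exists_fderiv_neg (h : IsLocalDefiningFunction S z ρ) (h0 : ρ z = 0) :
    ∃ N, fderiv ℝ ρ z N < 0 := by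
  have hne := h.fderiv_ne_zero h0
  contrapose! hne
  refine ContinuousLinearMap.ext fun a => le_antisymm ?_ (hne a)
  simpa using hne (-a)

theorem eventually (h : IsLocalDefiningFunction S z ρ) :
    ∀ᶠ w in 𝓝 z, IsLocalDefiningFunction S w ρ := by
  obtain ⟨V, hV, hz, hV'⟩ := h
  filter_upwards [hV.mem_nhds hz] with w hw using ⟨V, hV, hw, hV'⟩

theorem mem_iff (h : IsLocalDefiningFunction S z ρ) : z ∈ S ↔ ρ z ≤ 0 := by
  obtain ⟨V, -, hz, -, hS, -⟩ := h
  simpa [hz] using Set.ext_iff.1 hS z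

theorem mem_interior_iff (h : IsLocalDefiningFunction S z ρ) : z ∈ interior S ↔ ρ z < 0 := by
  refine ⟨fun hz => (h.mem_iff.1 (interior_subset hz)).lt_of_ne fun h0 => ?_, fun hz => ?_⟩
  · have hmax : IsLocalMax ρ z := by
      filter_upwards [h.eventually, mem_interior_iff_mem_nhds.1 hz] with w hw hwS
      exact h0 ▸ hw.mem_iff.1 hwS
    exact h.fderiv_ne_zero h0 hmax.fderiv_eq_zero
  · rw [mem_interior_iff_mem_nhds]
    filter_upwards [h.eventually, h.contDiffAt.continuousAt.eventually (gt_mem_nhds hz)]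
      with w hw hw0 using hw.mem_iff.2 hw0.le

theorem eq_zero_of_notMem_interior (h : IsLocalDefiningFunction S z ρ) (hz : z ∈ S)
    (hzi : z ∉ interior S) : ρ z = 0 :=
  le_antisymm (h.mem_iff.1 hz) (not_lt.1 fun hlt => hzi (h.mem_interior_iff.2 hlt))

theorem eventually_mem_sdiff_interior (h : IsLocalDefiningFunction S z ρ) :
    ∀ᶠ w in 𝓝 z, ρ w = 0 → w ∈ S \ interior S := by
  filter_upwards [h.eventually] with w hw h0
  exact ⟨hw.mem_iff.2 h0.le, fun hwi => (hw.mem_interior_iff.1 hwi).ne h0⟩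

theorem eventually_add_smul_mem_interior (h : IsLocalDefiningFunction S z ρ) (h0 : ρ z = 0)
    {a : CSpace n} (ha : fderiv ℝ ρ z a < 0) :
    ∀ᶠ t in 𝓝[>] (0 : ℝ), z + t • a ∈ interior S := by
  have hline : HasDerivAt (fun t : ℝ => z + t • a) a 0 := by
    simpa using ((hasDerivAt_id (0 : ℝ)).smul_const a).const_add z
  have hd : HasDerivAt (fun t : ℝ => ρ (z + t • a)) (fderiv ℝ ρ z a) 0 := by
    have hρ : HasFDerivAt ρ (fderiv ℝ ρ z) (z + (0 : ℝ) • a) := by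
      simpa using h.differentiableAt.hasFDerivAt
    exact hρ.comp_hasDerivAt 0 hline
  have hsign := eventually_nhdsWithin_sign_eq_of_deriv_neg (hd.deriv.symm ▸ ha) (by simpa using h0)
  filter_upwards [(tendsto_add_smul_nhdsGT z a).eventually h.eventually,
    nhdsWithin_le_nhds hsign, self_mem_nhdsWithin] with t ht hst (ht0 : 0 < t)
  rw [zero_sub, sign_neg (neg_neg_of_pos ht0), sign_eq_neg_one_iff] at hst
  exact ht.mem_interior_iff.2 hst

theorem mem_closure_interior (h : IsLocalDefiningFunction S z ρ) (hz : z ∈ S) :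
    z ∈ closure (interior S) := by
  by_cases hzi : z ∈ interior S
  · exact subset_closure hzi
  have h0 := h.eq_zero_of_notMem_interior hz hzi
  obtain ⟨N, hN⟩ := h.exists_fderiv_neg h0
  exact mem_closure_of_tendsto (tendsto_add_smul_nhdsGT z N)
    (h.eventually_add_smul_mem_interior h0 hN)

theorem uniqueDiffWithinAt (h : IsLocalDefiningFunction S z ρ) (hz : z ∈ S) :
    UniqueDiffWithinAt ℝ S z := by
  by_cases hzi : z ∈ interior S
  · exact uniqueDiffWithinAt_of_mem_nhds (mem_interior_iff_mem_nhds.1 hzi)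
  have h0 := h.eq_zero_of_notMem_interior hz hzi
  obtain ⟨N, hN⟩ := h.exists_fderiv_neg h0
  have hcone : {a | fderiv ℝ ρ z a < 0} ⊆ tangentConeAt ℝ S z := fun a ha =>
    mem_tangentConeAt_of_add_smul_mem (l := 𝓝[>] (0 : ℝ)) (c := id)
      (nhdsWithin_mono 0 fun t (ht : 0 < t) => ht.ne')
      ((h.eventually_add_smul_mem_interior h0 ha).mono fun t ht => interior_subset ht)
  have hopen : IsOpen {a | fderiv ℝ ρ z a < 0} :=
    isOpen_lt (fderiv ℝ ρ z).continuous continuous_const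
  have hspan : Submodule.span ℝ (tangentConeAt ℝ S z) = ⊤ :=
    Submodule.eq_top_of_nonempty_interior' _
      ⟨N, interior_maximal (hcone.trans Submodule.subset_span) hopen hN⟩
  exact ⟨by simp [hspan], subset_closure hz⟩

theorem fderiv_eq_zero_of_fderiv_eq_zero (h₁ : IsLocalDefiningFunction S z ρ₁)
    (h₂ : IsLocalDefiningFunction S z ρ₂) (hz : z ∈ S) (hzi : z ∉ interior S) {a : CSpace n}
    (ha : fderiv ℝ ρ₁ z a = 0) : fderiv ℝ ρ₂ z a = 0 := by
  have h0 := h₁.eq_zero_of_notMem_interior hz hzi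
  obtain ⟨γ, hγ, rfl, rfl, hργ⟩ :=
    exists_curve_in_zero_set two_ne_zero h₁.contDiffAt h0 (h₁.fderiv_ne_zero h0) ha
  have hρ₂ : ∀ᶠ t in 𝓝 0, ρ₂ (γ t) = 0 := by
    filter_upwards [hργ, hγ.continuousAt.eventually h₂.eventually,
      hγ.continuousAt.eventually h₁.eventually_mem_sdiff_interior] with t ht ht₂ htS
    exact ht₂.eq_zero_of_notMem_interior (htS ht).1 (htS ht).2
  simpa using fderivWithin_apply_deriv_eq_zero (S := univ)
    h₂.differentiableAt.differentiableWithinAt (hγ.differentiableAt two_ne_zero)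
    (.of_forall fun t => mem_univ _) hρ₂

end IsLocalDefiningFunction

theorem mem_nhds_of_leftInvOn {𝕜 E : Type*} [NontriviallyNormedField 𝕜] [CompleteSpace 𝕜]
    [NormedAddCommGroup E] [NormedSpace 𝕜 E] [FiniteDimensional 𝕜 E] {T T' : E → E}
    {L : E →L[𝕜] E} {D D' : Set E} {x : E} (hD : D ∈ 𝓝 x) (hT : HasStrictFDerivAt T L x)
    (hmaps : MapsTo T D D') (hinv : LeftInvOn T' T D)
    (hT' : DifferentiableWithinAt 𝕜 T' D' (T x)) : D' ∈ 𝓝 (T x) := by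
  have : CompleteSpace E := FiniteDimensional.complete 𝕜 E
  have hid : (fderivWithin 𝕜 T' D' (T x)).comp L = ContinuousLinearMap.id 𝕜 E :=
    ((hT'.hasFDerivWithinAt.comp x hT.hasFDerivAt.hasFDerivWithinAt hmaps).hasFDerivAt hD).unique
      ((hasFDerivAt_id x).congr_of_eventuallyEq (hinv.eqOn.eventuallyEq_of_mem hD))
  have hinj : Function.Injective L := fun a b hab => by
    simpa [hab] using (DFunLike.congr_fun hid a).symm.trans
      ((congrArg _ hab).trans (DFunLike.congr_fun hid b))
  have hrange : L.range = ⊤ := LinearMap.range_eq_top.2 (LinearMap.injective_iff_surjective.1 hinj)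
  rw [← hT.map_nhds_eq_of_surj hrange, mem_map]
  exact mem_of_superset hD hmaps

namespace ComplexManifoldWithBoundary

variable {n : ℕ} {M : Type*} [TopologicalSpace M] (X : ComplexManifoldWithBoundary n M)
  {e e' : PartialEquiv M (CSpace n)} {p : M}

theorem uniqueDiffOn_target (he : e ∈ X.atlas) : UniqueDiffOn ℝ e.target := fun z hz =>
  let ⟨_, hρ⟩ := X.c2_boundary e he z hz
  hρ.uniqueDiffWithinAt hz

theorem mem_interior_target (he : e ∈ X.atlas) (he' : e' ∈ X.atlas) (hp : p ∈ e.source)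
    (hp' : p ∈ e'.source) (hint : e p ∈ interior e.target) : e' p ∈ interior e'.target := by
  have hTp : (e' ∘ e.symm) (e p) = e' p := congrArg e' (e.left_inv hp)
  have hD : (e.symm.trans e').source ∈ 𝓝 (e p) := by
    have htarget := mem_interior_iff_mem_nhds.1 hint
    have hsymm := (X.continuousOn_symm e he).continuousAt htarget
    refine inter_mem htarget (hsymm.preimage_mem_nhds ?_)
    rw [e.left_inv hp]
    exact (X.isOpen_source e' he').mem_nhds hp'
  have hT := ((X.holomorphic e he e' he').contDiffAt hD).hasStrictFDerivAt (by simp)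
  have hmaps : MapsTo (e' ∘ e.symm) (e.symm.trans e').source (e'.symm.trans e).source :=
    (e.symm.trans e').mapsTo
  have hT' : DifferentiableWithinAt ℂ (e ∘ e'.symm) (e'.symm.trans e).source
      ((e' ∘ e.symm) (e p)) :=
    (X.holomorphic e' he' e he).differentiableOn (by simp) _ (hmaps (mem_of_mem_nhds hD))
  rw [mem_interior_iff_mem_nhds, ← hTp]
  exact mem_of_superset
    (mem_nhds_of_leftInvOn hD hT hmaps (e.symm.trans e').leftInvOn hT') inter_subset_left

theorem mem_boundary_iff (he : e ∈ X.atlas) (hp : p ∈ e.source) :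
    p ∈ X.boundary ↔ e p ∉ interior e.target :=
  ⟨fun ⟨_, he', hp', hb⟩ hint => hb (X.mem_interior_target he he' hp hp' hint),
    fun hb => ⟨e, he, hp, hb⟩⟩

theorem mem_inner_iff (he : e ∈ X.atlas) (hp : p ∈ e.source) :
    p ∈ X.inner ↔ e p ∈ interior e.target := by
  rw [inner, mem_compl_iff, X.mem_boundary_iff he hp, not_not]

theorem mem_closure_inner (p : M) : p ∈ closure X.inner := by
  obtain ⟨e, he, hp⟩ := X.cover p
  obtain ⟨ρ, hρ⟩ := X.c2_boundary e he (e p) (e.map_source hp)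
  have hcont : ContinuousWithinAt e.symm (interior e.target) (e p) :=
    (X.continuousOn_symm e he _ (e.map_source hp)).mono interior_subset
  rw [← e.left_inv hp]
  refine hcont.mem_closure (hρ.mem_closure_interior (e.map_source hp)) fun z hz => ?_
  rw [X.mem_inner_iff he (e.map_target (interior_subset hz)), e.right_inv (interior_subset hz)]
  exact hz

end ComplexManifoldWithBoundary

section SesquilinearForm

variable {n : ℕ}

/-- The sesquilinear form `(a, b) ↦ ∑ Gᵢⱼ aᵢ b̄ⱼ`. -/
abbrev sesq (G : Matrix (Fin n) (Fin n) ℂ) : CSpace n →ₗ[ℂ] CSpace n →ₗ⋆[ℂ] ℂ :=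
  Matrix.toLinearMapₛₗ₂' ℂ (RingHom.id ℂ) (starRingEnd ℂ) G

theorem sesq_apply (G : Matrix (Fin n) (Fin n) ℂ) (a b : CSpace n) :
    sesq G a b = ∑ i, ∑ j, G i j * (a i * star (b j)) := by
  rw [sesq, Matrix.toLinearMapₛₗ₂'_apply]
  refine Finset.sum_congr rfl fun i _ => Finset.sum_congr rfl fun j _ => ?_
  simp only [RingHom.id_apply, starRingEnd_apply, smul_eq_mul]
  ring

theorem sesq_add (G H : Matrix (Fin n) (Fin n) ℂ) : sesq (G + H) = sesq G + sesq H :=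
  map_add (Matrix.toLinearMapₛₗ₂' ℂ (RingHom.id ℂ) (starRingEnd ℂ)) G H

theorem sesq_sub (G H : Matrix (Fin n) (Fin n) ℂ) : sesq (G - H) = sesq G - sesq H :=
  map_sub (Matrix.toLinearMapₛₗ₂' ℂ (RingHom.id ℂ) (starRingEnd ℂ)) G H

theorem star_sesq {G : Matrix (Fin n) (Fin n) ℂ} (hG : G.IsHermitian) (a b : CSpace n) :
    star (sesq G a b) = sesq G b a := by
  simp only [sesq_apply, star_sum]
  rw [Finset.sum_comm]
  refine Finset.sum_congr rfl fun i _ => Finset.sum_congr rfl fun j _ => ?_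
  rw [star_mul', star_mul', star_star, hG.apply, mul_comm (star (a j))]

theorem mul_mul_conjTranspose_apply {ι : Type*} (P : Matrix ι (Fin n) ℂ)
    (G : Matrix (Fin n) (Fin n) ℂ) (i j : ι) :
    (P * G * P.conjTranspose) i j = sesq G (P i) (P j) := by
  simp only [sesq_apply, Matrix.mul_apply, Finset.sum_mul, Matrix.conjTranspose_apply]
  rw [Finset.sum_comm]
  exact Finset.sum_congr rfl fun k _ => Finset.sum_congr rfl fun l _ => by ring

theorem apply_eq_zero_of_forall_apply_self_eq_zero {V : Type*} [AddCommGroup V] [Module ℂ V]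
    {B : V →ₗ[ℂ] V →ₗ⋆[ℂ] ℂ} {W : Submodule ℂ V} (hB : ∀ a ∈ W, B a a = 0) {a b : V}
    (ha : a ∈ W) (hb : b ∈ W) : B a b = 0 := by
  have h1 := hB _ (W.add_mem ha hb)
  have h2 := hB _ (W.add_mem ha (W.smul_mem Complex.I hb))
  simp only [map_add, LinearMap.add_apply, LinearMap.map_smulₛₗ, LinearMap.smul_apply, hB a ha,
    hB b hb, Complex.conj_I, RingHom.id_apply, smul_eq_mul] at h1 h2
  have h3 : Complex.I * (B b a - B a b) = 0 := by linear_combination h2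
  have h4 := (mul_eq_zero.1 h3).resolve_left Complex.I_ne_zero
  linear_combination (h1 - h4) / 2

theorem form_mk_zero (G : Matrix (Fin n) (Fin n) ℂ) (a b : CSpace n) :
    form G (a, 0) (J (conjVec (b, 0))) = sesq G a b := by
  simp only [form, J, conjVec, sesq_apply, Finset.mul_sum]
  refine Finset.sum_congr rfl fun i _ => Finset.sum_congr rfl fun j _ => ?_
  simp only [Pi.smul_apply, Pi.star_apply, Pi.zero_apply, smul_eq_mul, mul_zero, sub_zero]
  linear_combination (-(G i j * (a i * star (b j)))) * Complex.I_mul_I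

theorem tensor_mk_zero {M : Type*} [TopologicalSpace M] {X : ComplexManifoldWithBoundary n M}
    (g : X.HermitianMetric) (e : PartialEquiv M (CSpace n)) (z a b : CSpace n) :
    g.tensor e z (a, 0) (conjVec (b, 0)) = sesq (g.coeff e z) a b :=
  form_mk_zero _ _ _

theorem tensor_ofReal {M : Type*} [TopologicalSpace M] {X : ComplexManifoldWithBoundary n M}
    (g : X.HermitianMetric) (e : PartialEquiv M (CSpace n)) (z a b : CSpace n) :
    g.tensor e z (ofReal a) (ofReal b) = sesq (g.coeff e z) a b + sesq (g.coeff e z) b a := by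
  simp only [ComplexManifoldWithBoundary.HermitianMetric.tensor, form, J, ofReal, sesq_apply,
    Finset.mul_sum, ← Finset.sum_add_distrib]
  refine Finset.sum_congr rfl fun i _ => Finset.sum_congr rfl fun j _ => ?_
  simp only [Pi.smul_apply, Pi.star_apply, smul_eq_mul]
  linear_combination (-(g.coeff e z i j * (a i * star (b j) + b i * star (a j)))) *
    Complex.I_mul_I

theorem eq_mk_zero_of_J_eq {ξ : CTangent n} (h : J ξ = Complex.I • ξ) : ξ = (ξ.1, 0) := by
  have h2 : -Complex.I • ξ.2 = Complex.I • ξ.2 := congrArg Prod.snd h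
  rw [neg_smul, neg_eq_self, smul_eq_zero_iff_right Complex.I_ne_zero] at h2
  exact Prod.ext rfl h2

theorem J_mk_zero (a : CSpace n) : J (a, 0) = Complex.I • ((a, 0) : CTangent n) := by
  simp [J, Prod.smul_mk]

theorem half_smul_ofReal_sub (ν : CSpace n) :
    (1 / 2 : ℂ) • (ofReal ν - Complex.I • J (ofReal ν)) = (ν, 0) := by
  simp only [ofReal, J, Prod.smul_mk, Prod.mk_sub_mk, smul_smul, mul_neg, Complex.I_mul_I, neg_neg,
    neg_one_smul, one_smul, sub_neg_eq_add, sub_self, smul_zero, ← two_smul ℂ ν]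
  norm_num

end SesquilinearForm

section ComplexHessian

variable {n : ℕ}

/-- The complex tangent space `T ∩ JT` of a level set of `ρ` at `z`: the kernel of the `ℂ`-linear
functional `∂ρ` with real part `dρ`. -/
noncomputable def complexTangentSpace (ρ : CSpace n → ℝ) (z : CSpace n) : Submodule ℂ (CSpace n) :=
  (Module.Dual.extendRCLike (𝕜 := ℂ) (fderiv ℝ ρ z : Module.Dual ℝ (CSpace n))).ker

variable {ρ v h : CSpace n → ℝ} {S : Set (CSpace n)} {z : CSpace n}

theorem mem_complexTangentSpace {a : CSpace n} : a ∈ complexTangentSpace ρ z ↔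
    fderiv ℝ ρ z a = 0 ∧ fderiv ℝ ρ z (Complex.I • a) = 0 := by
  rw [complexTangentSpace, LinearMap.mem_ker, Complex.ext_iff]
  simp [Module.Dual.extendRCLike_apply]

theorem I_smul_single (i : Fin n) :
    Complex.I • (Pi.single i 1 : CSpace n) = Pi.single i Complex.I := by
  simp [← Pi.single_smul]

theorem dC_mk_zero (ρ : CSpace n → ℝ) (z a : CSpace n) : dC ρ z (a, 0) =
    Module.Dual.extendRCLike (𝕜 := ℂ) (fderiv ℝ ρ z : Module.Dual ℝ (CSpace n)) a / 2 := by
  simp only [dC, Pi.zero_apply, mul_zero, add_zero]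
  rw [LinearMap.pi_apply_eq_sum_univ (Module.Dual.extendRCLike (𝕜 := ℂ) (F := CSpace n) _) a,
    Finset.sum_div]
  refine Finset.sum_congr rfl fun i _ => ?_
  have hsingle : (fun j => if i = j then (1 : ℂ) else 0) = Pi.single i 1 := by
    ext j
    simp [Pi.single_apply, eq_comm]
  rw [hsingle, Module.Dual.extendRCLike_apply]
  simp only [RCLike.I_to_complex, I_smul_single, ContinuousLinearMap.coe_coe,
    Complex.coe_algebraMap, smul_eq_mul]
  ring

theorem dC_mk_zero_eq_zero_iff {a : CSpace n} :
    dC ρ z (a, 0) = 0 ↔ a ∈ complexTangentSpace ρ z := by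
  rw [dC_mk_zero, div_eq_zero_iff, or_iff_left two_ne_zero]
  rfl

section LeviForm

variable {E : Type*} [NormedAddCommGroup E] [NormedSpace ℂ E]

theorem smul_eq_re_smul_add_im_smul (c : ℂ) (a : E) :
    c • a = c.re • a + c.im • Complex.I • a := by
  rw [← Complex.coe_smul c.re, ← Complex.coe_smul c.im, smul_smul, ← add_smul, Complex.re_add_im]

theorem I_smul_smul_eq (c : ℂ) (a : E) :
    Complex.I • c • a = c.re • Complex.I • a - c.im • a := by
  rw [smul_comm, smul_eq_re_smul_add_im_smul, smul_smul Complex.I, Complex.I_mul_I, neg_one_smul,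
    smul_neg, sub_eq_add_neg]

/-- The Levi form of a real bilinear form `D` on a complex space. If `D` is the second derivative of
a function, its matrix in the standard basis is the complex Hessian `∂²/∂zᵢ∂z̄ⱼ`. -/
noncomputable def leviForm (D : E →L[ℝ] E →L[ℝ] ℝ) : E →ₗ[ℂ] E →ₗ⋆[ℂ] ℂ :=
  LinearMap.mk₂'ₛₗ (RingHom.id ℂ) (starRingEnd ℂ)
    (fun a b => ((D a b + D (Complex.I • a) (Complex.I • b) : ℝ)
      + Complex.I * (D a (Complex.I • b) - D (Complex.I • a) b : ℝ)) / 4)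
    (fun a a' b => by simp only [smul_add, map_add, add_apply]; push_cast; ring)
    (fun c a b => by
      rw [I_smul_smul_eq, smul_eq_re_smul_add_im_smul c a]
      apply Complex.ext <;> simp <;> ring)
    (fun a b b' => by simp only [smul_add, map_add]; push_cast; ring)
    (fun c a b => by
      rw [I_smul_smul_eq, smul_eq_re_smul_add_im_smul c b]
      apply Complex.ext <;> simp <;> ring)

theorem leviForm_apply (D : E →L[ℝ] E →L[ℝ] ℝ) (a b : E) : leviForm D a b =
    ((D a b + D (Complex.I • a) (Complex.I • b) : ℝ)
      + Complex.I * (D a (Complex.I • b) - D (Complex.I • a) b : ℝ)) / 4 :=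
  rfl

theorem leviForm_apply_self_re (D : E →L[ℝ] E →L[ℝ] ℝ) (a : E) : (leviForm D a a).re =
    (D a a + D (Complex.I • a) (Complex.I • a)) / 4 := by
  simp [leviForm_apply]

theorem leviForm_sub (D D' : E →L[ℝ] E →L[ℝ] ℝ) :
    leviForm (D - D') = leviForm D - leviForm D' := by
  ext a b
  simp only [leviForm_apply, LinearMap.sub_apply, sub_apply]
  push_cast
  ring

theorem star_leviForm {D : E →L[ℝ] E →L[ℝ] ℝ} (hD : ∀ a b, D a b = D b a) (a b : E) :
    star (leviForm D a b) = leviForm D b a := by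
  rw [leviForm_apply, leviForm_apply, hD b a, hD (Complex.I • b), hD b, hD (Complex.I • b) a]
  apply Complex.ext <;> simp

end LeviForm

theorem complexHessian_eq_toMatrix (v : CSpace n → ℝ) (S : Set (CSpace n)) (z : CSpace n) :
    complexHessian v S z =
      LinearMap.toMatrixₛₗ₂' ℂ (leviForm (fderivWithin ℝ (fderivWithin ℝ v S) S z)) := by
  ext i j
  rw [LinearMap.toMatrixₛₗ₂'_apply, leviForm_apply, I_smul_single, I_smul_single]
  rfl

theorem sesq_complexHessian (v : CSpace n → ℝ) (S : Set (CSpace n)) (z : CSpace n) :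
    sesq (complexHessian v S z) = leviForm (fderivWithin ℝ (fderivWithin ℝ v S) S z) := by
  rw [complexHessian_eq_toMatrix, sesq, Matrix.toLinearMapₛₗ₂'_toMatrix']

theorem isHermitian_complexHessian (hv : ContDiffOn ℝ 2 v S) (hS : UniqueDiffOn ℝ S)
    (hz : z ∈ closure (interior S)) (hzS : z ∈ S) : (complexHessian v S z).IsHermitian := by
  refine Matrix.IsHermitian.ext fun i j => ?_
  rw [complexHessian_eq_toMatrix, LinearMap.toMatrixₛₗ₂'_apply, LinearMap.toMatrixₛₗ₂'_apply]
  exact star_leviForm ((hv z hzS).isSymmSndFDerivWithinAt (by simp) hS hz hzS) _ _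

theorem continuousOn_complexHessian (hv : ContDiffOn ℝ 2 v S) (hS : UniqueDiffOn ℝ S) :
    ContinuousOn (complexHessian v S) S := by
  have h2 : ContinuousOn (fderivWithin ℝ (fderivWithin ℝ v S) S) S :=
    (hv.fderivWithin hS (m := 1) (by norm_num)).continuousOn_fderivWithin hS le_rfl
  have h3 (a b : CSpace n) : ContinuousOn (fun z => secondDeriv v S z a b) S :=
    (h2.clm_apply continuousOn_const).clm_apply continuousOn_const
  refine continuousOn_pi.2 fun i => continuousOn_pi.2 fun j => ?_
  simp only [complexHessian, Matrix.of_apply]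
  fun_prop

theorem complexHessian_sub (hv : ContDiffOn ℝ 2 v S) (hh : ContDiffOn ℝ 2 h S)
    (hS : UniqueDiffOn ℝ S) (hzS : z ∈ S) :
    complexHessian (v - h) S z = complexHessian v S z - complexHessian h S z := by
  have hdiff {w : CSpace n → ℝ} (hw : ContDiffOn ℝ 2 w S) :
      DifferentiableWithinAt ℝ (fderivWithin ℝ w S) S z :=
    (hw.fderivWithin hS (m := 1) (by norm_num)).differentiableOn one_ne_zero z hzS
  have hfirst : ∀ y ∈ S, fderivWithin ℝ (v - h) S y = fderivWithin ℝ v S y - fderivWithin ℝ h S y :=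
    fun y hy => fderivWithin_sub (hS y hy) (hv.differentiableOn two_ne_zero y hy)
      (hh.differentiableOn two_ne_zero y hy)
  rw [complexHessian_eq_toMatrix, fderivWithin_congr hfirst (hfirst z hzS),
    fderivWithin_fun_sub (hS z hzS) (hdiff hv) (hdiff hh), leviForm_sub, map_sub,
    ← complexHessian_eq_toMatrix, ← complexHessian_eq_toMatrix]

theorem sesq_complexHessian_eq_zero (hh : ContDiffOn ℝ 2 h S) (hS : UniqueDiffOn ℝ S)
    (hρ : IsLocalDefiningFunction S z ρ) (hz : z ∈ closure (interior S)) (hzS : z ∈ S)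
    (hzi : z ∉ interior S) (hvan : ∀ w ∈ S, w ∉ interior S → h w = 0)
    (hlevi : ∀ a ∈ complexTangentSpace ρ z, sesq (complexHessian ρ univ z) a a = 0) {a b : CSpace n}
    (ha : a ∈ complexTangentSpace ρ z) (hb : b ∈ complexTangentSpace ρ z) :
    sesq (complexHessian h S z) a b = 0 := by
  have h0 := hρ.eq_zero_of_notMem_interior hzS hzi
  have hρS : ∀ᶠ w in 𝓝 z, ρ w = 0 → w ∈ S ∧ h w = 0 := by
    filter_upwards [hρ.eventually_mem_sdiff_interior] with w hw hw0
    exact ⟨(hw hw0).1, hvan w (hw hw0).1 (hw hw0).2⟩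
  obtain ⟨c, hc⟩ := exists_fderivWithin_fderivWithin_apply_eq_mul hS hh hρ.contDiffAt h0
    (hρ.fderiv_ne_zero h0) hρS
  refine apply_eq_zero_of_forall_apply_self_eq_zero (fun a ha => ?_) ha hb
  obtain ⟨ha1, ha2⟩ := mem_complexTangentSpace.1 ha
  have hre : (sesq (complexHessian h S z) a a).re =
      c * (sesq (complexHessian ρ univ z) a a).re := by
    rw [sesq_complexHessian, sesq_complexHessian, leviForm_apply_self_re, leviForm_apply_self_re,
      hc a ha1, hc _ ha2, fderivWithin_univ]
    simp only [fderivWithin_univ]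
    ring
  have him : (sesq (complexHessian h S z) a a).im = 0 :=
    Complex.conj_eq_iff_im.1 (star_sesq (isHermitian_complexHessian hh hS hz hzS) a a)
  exact Complex.ext (by simp [hre, hlevi a ha]) him

end ComplexHessian

section Spectrum

open Polynomial Matrix

variable {ι : Type*}

theorem exists_perm_eq_comp_of_map_eq {α : Type*} [Fintype ι] {f g : ι → α}
    (h : Finset.univ.val.map f = Finset.univ.val.map g) : ∃ σ : Equiv.Perm ι, f = g ∘ σ := by
  classical
  have hcard (c : α) : Fintype.card {x // f x = c} = Fintype.card {x // g x = c} := by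
    have hc := congrArg (Multiset.count c) h
    rw [Multiset.count_map, Multiset.count_map] at hc
    rw [Fintype.card_subtype, Fintype.card_subtype]
    simpa [Finset.card_def, eq_comm] using hc
  let σ : Equiv.Perm ι := Equiv.ofFiberEquiv fun c => Fintype.equivOfCardEq (hcard c)
  exact ⟨σ, funext fun x => (Equiv.ofFiberEquiv_map _ x).symm⟩

variable [Fintype ι] [DecidableEq ι] {A : Matrix ι ι ℂ} {l l' : ι → ℝ}

/-- The family `l` lists the eigenvalues of `A`, all of them real, with multiplicity. -/
def HasSpectrum (A : Matrix ι ι ℂ) (l : ι → ℝ) : Prop :=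
  A.charpoly = ∏ i, (X - C (l i : ℂ))

theorem hasSpectrum_eigenvalues (hA : A.IsHermitian) : HasSpectrum A hA.eigenvalues :=
  hA.charpoly_eq

theorem HasSpectrum.exists_perm (h : HasSpectrum A l) (h' : HasSpectrum A l') :
    ∃ σ : Equiv.Perm ι, l = l' ∘ σ := by
  have hroots {l : ι → ℝ} (hl : HasSpectrum A l) :
      A.charpoly.roots = (Finset.univ.val.map l).map Complex.ofReal := by
    have hprod := roots_multiset_prod_X_sub_C (Finset.univ.val.map fun i => (l i : ℂ))
    rw [Multiset.map_map] at hprod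
    rw [hl, Multiset.map_map]
    exact hprod
  exact exists_perm_eq_comp_of_map_eq
    (Multiset.map_injective Complex.ofReal_injective ((hroots h).symm.trans (hroots h')))

theorem HasSpectrum.conj {P Q : Matrix ι ι ℂ} (hA : HasSpectrum A l) (hPQ : Q * P = 1) :
    HasSpectrum (P * A * Q) l := by
  rw [HasSpectrum, Matrix.mul_assoc, Matrix.charpoly_mul_comm, Matrix.mul_assoc, hPQ,
    Matrix.mul_one]
  exact hA

theorem hasSpectrum_inv_mul_iff {G P : Matrix ι ι ℂ} (hP : P * G * Pᴴ = 1) :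
    HasSpectrum (G⁻¹ * A) l ↔ HasSpectrum (P * A * Pᴴ) l := by
  have hG : G * (Pᴴ * P) = 1 := by
    rw [← Matrix.mul_assoc, mul_eq_one_comm, ← Matrix.mul_assoc, hP]
  rw [HasSpectrum, HasSpectrum, Matrix.inv_eq_right_inv hG, Matrix.mul_assoc,
    Matrix.charpoly_mul_comm]

theorem hasSpectrum_iff_forall_det :
    HasSpectrum A l ↔ ∀ x : ℂ, (Matrix.scalar ι x - A).det = ∏ i, (x - l i) := by
  have heval (x : ℂ) : (∏ i, (X - C (l i : ℂ))).eval x = ∏ i, (x - l i) := by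
    simp [Polynomial.eval_prod]
  refine ⟨fun h x => ?_, fun h => Polynomial.funext fun x => ?_⟩
  · rw [← Matrix.eval_charpoly, h, heval]
  · rw [Matrix.eval_charpoly, h, heval]

theorem isClosed_setOf_hasSpectrum :
    IsClosed {q : Matrix ι ι ℂ × (ι → ℝ) | HasSpectrum q.1 q.2} := by
  simp only [hasSpectrum_iff_forall_det, Set.ofPred_forall]
  exact isClosed_iInter fun x => isClosed_eq
    (continuous_const.sub continuous_fst).matrix_det (by fun_prop)

theorem HasSpectrum.abs_le (h : HasSpectrum A l) (i : ι) : |l i| ≤ ∑ k, ∑ j, ‖A k j‖ := by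
  have hroot : A.charpoly.IsRoot (l i) := by
    rw [h, IsRoot.def, Polynomial.eval_prod]
    exact Finset.prod_eq_zero (Finset.mem_univ i) (by simp)
  have heig : Module.End.HasEigenvalue (Matrix.toLin' A) (l i : ℂ) := by
    rwa [Module.End.hasEigenvalue_iff_isRoot_charpoly, Matrix.charpoly_toLin']
  obtain ⟨k, hk⟩ := eigenvalue_mem_ball heig
  calc |l i| = ‖(l i : ℂ)‖ := (Complex.norm_real _).symm
    _ ≤ ‖A k k‖ + ∑ j ∈ Finset.univ.erase k, ‖A k j‖ := norm_le_norm_add_const_of_dist_le hk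
    _ = ∑ j, ‖A k j‖ := Finset.add_sum_erase _ (fun j => ‖A k j‖) (Finset.mem_univ k)
    _ ≤ ∑ k, ∑ j, ‖A k j‖ :=
      Finset.single_le_sum (f := fun k => ∑ j, ‖A k j‖)
        (fun _ _ => Finset.sum_nonneg fun _ _ => norm_nonneg _) (Finset.mem_univ k)

theorem tendsto_of_hasSpectrum {T β : Type*} {F : Filter T} [TopologicalSpace β]
    {A : T → Matrix ι ι ℂ} {A₀ : Matrix ι ι ℂ} {l : T → ι → ℝ} {l₀ : ι → ℝ} {f : (ι → ℝ) → β}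
    (hf : ∀ σ : Equiv.Perm ι, Tendsto f (𝓝 (l₀ ∘ σ)) (𝓝 (f l₀))) (hA : Tendsto A F (𝓝 A₀))
    (hl : ∀ᶠ t in F, HasSpectrum (A t) (l t)) (hl₀ : HasSpectrum A₀ l₀) :
    Tendsto (fun t => f (l t)) F (𝓝 (f l₀)) := by
  rw [tendsto_iff_ultrafilter]
  intro U hU
  have hnorm : Tendsto (fun t => ∑ k, ∑ j, ‖A t k j‖) F (𝓝 (∑ k, ∑ j, ‖A₀ k j‖)) :=
    tendsto_finsetSum _ fun k _ => tendsto_finsetSum _ fun j _ =>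
      (tendsto_pi_nhds.1 (tendsto_pi_nhds.1 hA k) j).norm
  obtain ⟨c, hc⟩ := exists_gt (∑ k, ∑ j, ‖A₀ k j‖)
  have hbound : ∀ᶠ t in U, l t ∈ Set.pi univ fun _ => Icc (-c) c := by
    filter_upwards [hl.filter_mono hU, (hnorm.mono_left hU).eventually_lt_const hc]
      with t hlt hct i _
    exact abs_le.1 ((hlt.abs_le i).trans hct.le)
  obtain ⟨l', -, hl' : Tendsto l U (𝓝 l')⟩ :=
    (isCompact_univ_pi fun _ => isCompact_Icc).ultrafilter_le_nhds (U.map l)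
      (le_principal_iff.2 hbound)
  have hmem : (A₀, l') ∈ {q : Matrix ι ι ℂ × (ι → ℝ) | HasSpectrum q.1 q.2} :=
    isClosed_setOf_hasSpectrum.mem_of_tendsto ((hA.mono_left hU).prodMk_nhds hl')
      (hl.filter_mono hU)
  obtain ⟨σ, rfl⟩ := HasSpectrum.exists_perm hmem hl₀
  exact (hf σ).comp hl'

end Spectrum

section Schur

open Matrix

variable {ι : Type*}

theorem range_comp_perm_comp (l : ι → ℝ) (σ : Equiv.Perm ι) :
    (range fun τ : Equiv.Perm ι => (l ∘ σ) ∘ τ) = range fun τ : Equiv.Perm ι => l ∘ τ :=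
  (Equiv.mulLeft σ).surjective.range_comp fun τ : Equiv.Perm ι => l ∘ τ

variable [Fintype ι] [DecidableEq ι] {A U : Matrix ι ι ℂ} {l : ι → ℝ}

theorem norm_sq_mem_doublyStochastic (hU : U ∈ Matrix.unitaryGroup ι ℂ) :
    Matrix.of (fun i j => ‖U i j‖ ^ 2) ∈ doublyStochastic ℝ ι := by
  rw [mem_doublyStochastic_iff_sum]
  refine ⟨fun i j => sq_nonneg ‖U i j‖, fun i => ?_, fun j => ?_⟩ <;> apply Complex.ofReal_injective
  · simpa [Matrix.mul_apply, Complex.mul_conj, Complex.normSq_eq_norm_sq] using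
      congr_fun₂ (Matrix.mem_unitaryGroup_iff.1 hU) i i
  · simpa [Matrix.mul_apply, mul_comm, Complex.mul_conj, Complex.normSq_eq_norm_sq] using
      congr_fun₂ (Matrix.mem_unitaryGroup_iff'.1 hU) j j

theorem mulVec_mem_convexHull_range_comp {D : Matrix ι ι ℝ} (hD : D ∈ doublyStochastic ℝ ι)
    (l : ι → ℝ) : D *ᵥ l ∈ convexHull ℝ (range fun σ : Equiv.Perm ι => l ∘ σ) := by
  obtain ⟨w, hw, hw1, rfl⟩ := exists_eq_sum_perm_of_mem_doublyStochastic hD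
  simp only [Matrix.sum_mulVec, Matrix.smul_mulVec, Matrix.permMatrix_mulVec]
  exact (convex_convexHull ℝ _).sum_mem (fun σ _ => hw σ) hw1 fun σ _ =>
    subset_convexHull ℝ _ ⟨σ, rfl⟩

theorem HasSpectrum.re_diag_mem_convexHull (hA : A.IsHermitian) (hl : HasSpectrum A l) :
    (fun i => (A i i).re) ∈ convexHull ℝ (range fun σ : Equiv.Perm ι => l ∘ σ) := by
  obtain ⟨σ, hσ⟩ := (hasSpectrum_eigenvalues hA).exists_perm hl
  have hdiag : (fun i => (A i i).re) =
      Matrix.of (fun i j => ‖(hA.eigenvectorUnitary : Matrix ι ι ℂ) i j‖ ^ 2) *ᵥ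
        hA.eigenvalues := by
    ext i
    conv_lhs => rw [hA.spectral_theorem, Unitary.conjStarAlgAut_apply]
    rw [Matrix.mul_apply, Complex.re_sum, Matrix.mulVec, dotProduct]
    refine Finset.sum_congr rfl fun j _ => ?_
    rw [Matrix.mul_diagonal, Matrix.star_apply, mul_right_comm, Complex.star_def, Complex.mul_conj,
      Complex.normSq_eq_norm_sq]
    exact Complex.re_ofReal_mul _ _
  rw [← range_comp_perm_comp l σ, ← hσ, hdiag]
  exact mulVec_mem_convexHull_range_comp (norm_sq_mem_doublyStochastic hA.eigenvectorUnitary.2) _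

end Schur

section Cone

variable {ι : Type*}

/-- The union of the permutohedra of the elements of `K`. The diagonals of the Hermitian matrices
with spectrum in `K` lie in it. -/
def symmHull (K : Set (ι → ℝ)) : Set (ι → ℝ) :=
  ⋃ l ∈ K, convexHull ℝ (range fun σ : Equiv.Perm ι => l ∘ σ)

theorem convexHull_range_eq_image_stdSimplex {κ E : Type*} [Fintype κ] [AddCommGroup E]
    [Module ℝ E] (v : κ → E) :
    convexHull ℝ (range v) = Fintype.linearCombination ℝ v '' stdSimplex ℝ κ := by
  classical
  rw [← convexHull_rangle_single_eq_stdSimplex, LinearMap.image_convexHull, ← range_comp]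
  congr 2
  funext k
  rw [Function.comp_apply, Fintype.linearCombination_apply_single, one_smul]

theorem isCompact_symmHull [Finite ι] {K : Set (ι → ℝ)} (hK : IsCompact K) :
    IsCompact (symmHull K) := by
  classical
  cases nonempty_fintype ι
  simp only [symmHull, convexHull_range_eq_image_stdSimplex]
  rw [iUnion_image_left fun l : ι → ℝ =>
    ⇑(Fintype.linearCombination ℝ fun σ : Equiv.Perm ι => l ∘ σ), ← image_uncurry_prod]
  refine (hK.prod (isCompact_stdSimplex ℝ _)).image (continuous_finsetSum _ fun σ _ => ?_)
  exact ((continuous_apply σ).comp continuous_snd).smul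
    (continuous_pi fun i => (continuous_apply (σ i)).comp continuous_fst)

theorem mem_and_le_of_mem_convexHull {Γ : Set (ι → ℝ)} {f : (ι → ℝ) → ℝ} {l μ : ι → ℝ}
    (hf : QuasiconcaveOn ℝ Γ f)
    (hsymm : ∀ l ∈ Γ, ∀ σ : Equiv.Perm ι, l ∘ σ ∈ Γ ∧ f (l ∘ σ) = f l) (hl : l ∈ Γ)
    (hμ : μ ∈ convexHull ℝ (range fun σ : Equiv.Perm ι => l ∘ σ)) : μ ∈ Γ ∧ f l ≤ f μ := by
  refine convexHull_min ?_ (hf (f l)) hμ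
  rintro _ ⟨σ, rfl⟩
  exact ⟨(hsymm l hl σ).1, (hsymm l hl σ).2.ge⟩

theorem exists_pos_forall_lt_add_sub [Fintype ι] {Γ K : Set (ι → ℝ)} {f : (ι → ℝ) → ℝ}
    (hΓ : IsOpen Γ) (hupper : IsUpperSet Γ) (hf : ContinuousOn f Γ) (hmono : StrictMonoOn f Γ)
    (hK : IsCompact K) (hKΓ : K ⊆ Γ) :
    ∃ ε : ℝ, 0 < ε ∧ ∀ μ ∈ K, ∀ d ∈ stdSimplex ℝ ι,
      μ + d - ε • (1 : ι → ℝ) ∈ Γ ∧ f μ < f (μ + d - ε • (1 : ι → ℝ)) := by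
  let P (ε : ℝ) (q : (ι → ℝ) × (ι → ℝ)) : Prop :=
    q.1 + q.2 - ε • (1 : ι → ℝ) ∈ Γ ∧ f q.1 < f (q.1 + q.2 - ε • (1 : ι → ℝ))
  have hnear : ∀ q ∈ K ×ˢ stdSimplex ℝ ι,
      ∀ᶠ z : ℝ × (ι → ℝ) × (ι → ℝ) in 𝓝 (0, q), P z.1 z.2 := by
    rintro ⟨μ, d⟩ ⟨hμ : μ ∈ K, hd : d ∈ stdSimplex ℝ ι⟩
    have hμd : μ < μ + d := by
      refine lt_add_of_pos_right μ (lt_of_le_of_ne hd.1 fun h => ?_)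
      simpa [← h] using hd.2
    have hmem : μ + d ∈ Γ := hupper hμd.le (hKΓ hμ)
    have hshift : Tendsto (fun z : ℝ × (ι → ℝ) × (ι → ℝ) => z.2.1 + z.2.2 - z.1 • (1 : ι → ℝ))
        (𝓝 (0, μ, d)) (𝓝 (μ + d)) :=
      Continuous.tendsto' (by fun_prop) _ _ (by simp)
    have hfst : Tendsto (fun z : ℝ × (ι → ℝ) × (ι → ℝ) => z.2.1) (𝓝 (0, μ, d)) (𝓝 μ) :=
      Continuous.tendsto' (by fun_prop) _ _ rfl
    exact (hshift.eventually_mem (hΓ.mem_nhds hmem)).and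
      (((hf.continuousAt (hΓ.mem_nhds (hKΓ hμ))).tendsto.comp hfst).eventually_lt
        ((hf.continuousAt (hΓ.mem_nhds hmem)).tendsto.comp hshift) (hmono (hKΓ hμ) hmem hμd))
  have hsmall : ∀ᶠ ε in 𝓝 0, ∀ q ∈ K ×ˢ stdSimplex ℝ ι, P ε q :=
    (hK.prod (isCompact_stdSimplex ℝ ι)).eventually_forall_of_forall_eventually hnear
  obtain ⟨ε, hε, hε0 : 0 < ε⟩ :=
    ((hsmall.filter_mono nhdsWithin_le_nhds).and (self_mem_nhdsWithin (s := Ioi 0))).exists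
  exact ⟨ε, hε0, fun μ hμ d hd => hε (μ, d) ⟨hμ, hd⟩⟩

theorem strictMonoOn_of_fderiv_single_pos [Finite ι] [DecidableEq ι] {Γ : Set (ι → ℝ)}
    {f : (ι → ℝ) → ℝ} (hΓ : IsUpperSet Γ) (hf : ∀ x ∈ Γ, DifferentiableAt ℝ f x)
    (hpos : ∀ x ∈ Γ, ∀ i, 0 < fderiv ℝ f x (Pi.single i 1)) : StrictMonoOn f Γ := by
  have := Fintype.ofFinite ι
  intro x hx y _ hxy
  have hmem : ∀ t ∈ Icc (0 : ℝ) 1, AffineMap.lineMap x y t ∈ Γ := fun t ht =>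
    hΓ (by
      rw [AffineMap.lineMap_apply_module']
      exact le_add_of_nonneg_left (smul_nonneg ht.1 (sub_nonneg.2 hxy.le))) hx
  have hder : ∀ t ∈ Icc (0 : ℝ) 1, HasDerivAt (f ∘ AffineMap.lineMap x y)
      (fderiv ℝ f (AffineMap.lineMap x y t) (y - x)) t := fun t ht =>
    (hf _ (hmem t ht)).hasFDerivAt.comp_hasDerivAt t AffineMap.hasDerivAt_lineMap
  have hder_pos : ∀ z ∈ Γ, 0 < fderiv ℝ f z (y - x) := by
    intro z hz
    obtain ⟨hnonneg, j, hj⟩ := Pi.lt_def.1 (sub_pos.2 hxy)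
    rw [pi_eq_sum_univ' (y - x), map_sum]
    refine Finset.sum_pos' (fun i _ => ?_) ⟨j, Finset.mem_univ j, ?_⟩ <;>
      rw [map_smul]
    · exact smul_nonneg (hnonneg i) (hpos z hz i).le
    · exact smul_pos hj (hpos z hz j)
  have hline : StrictMonoOn (f ∘ AffineMap.lineMap x y) (Icc (0 : ℝ) 1) := by
    refine strictMonoOn_of_deriv_pos (convex_Icc _ _)
      (fun t ht => (hder t ht).continuousAt.continuousWithinAt) fun t ht => ?_
    rw [(hder t (interior_subset ht)).deriv]
    exact hder_pos _ (hmem t (interior_subset ht))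
  simpa using hline (left_mem_Icc.2 zero_le_one) (right_mem_Icc.2 zero_le_one) zero_lt_one

variable {n : ℕ} {Γ : Set (Fin n → ℝ)} {f : (Fin n → ℝ) → ℝ}

theorem IsSymmetricCone.isUpperSet (hΓ : IsSymmetricCone Γ) : IsUpperSet Γ := by
  intro x y hxy hx
  have hshift : Tendsto (fun ε : ℝ => x - ε • (1 : Fin n → ℝ)) (𝓝[>] 0) (𝓝 x) :=
    (Continuous.tendsto' (by fun_prop) _ _ (by simp)).mono_left nhdsWithin_le_nhds
  obtain ⟨ε, hε, hε0 : 0 < ε⟩ :=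
    ((hshift.eventually_mem (hΓ.isOpen.mem_nhds hx)).and self_mem_nhdsWithin).exists
  have hpos : y - x + ε • (1 : Fin n → ℝ) ∈ Γ := hΓ.positive_subset _ fun i => by
    simpa using add_pos_of_nonneg_of_pos (sub_nonneg.2 (hxy i)) hε0
  have hmid := hΓ.cone _ (hΓ.convex hε hpos one_half_pos.le one_half_pos.le (add_halves 1)) 2
    two_pos
  convert hmid using 1
  module

theorem IsStructureFunction.strictMonoOn (hf : IsStructureFunction Γ f) (hΓ : IsSymmetricCone Γ) :
    StrictMonoOn f Γ :=
  strictMonoOn_of_fderiv_single_pos hΓ.isUpperSet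
    (fun _ hx => (hf.smooth.contDiffAt (hΓ.isOpen.mem_nhds hx)).differentiableAt (by simp))
    hf.elliptic

end Cone

section LastDiagonalEntry

open Matrix

variable {m : ℕ} {A B H : Matrix (Fin (m + 1)) (Fin (m + 1)) ℂ} {ε : ℝ}

theorem re_sesq_self_of_block_eq_zero (hH : H.IsHermitian)
    (h0 : ∀ α β : Fin m, H α.castSucc β.castSucc = 0) (x : CSpace (m + 1)) :
    (sesq H x x).re =
      2 * ∑ α : Fin m, (H α.castSucc (.last m) * (x α.castSucc * star (x (.last m)))).re +
        (H (.last m) (.last m)).re * ‖x (.last m)‖ ^ 2 := by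
  have hsymm (α : Fin m) : (H (.last m) α.castSucc * (x (.last m) * star (x α.castSucc))).re =
      (H α.castSucc (.last m) * (x α.castSucc * star (x (.last m)))).re := by
    rw [← hH.apply, ← Complex.conj_re, ← Complex.star_def]
    simp only [star_mul', star_star, mul_comm (x (.last m))]
  have hlast : (H (.last m) (.last m) * (x (.last m) * star (x (.last m)))).re =
      (H (.last m) (.last m)).re * ‖x (.last m)‖ ^ 2 := by
    rw [Complex.star_def, Complex.mul_conj, Complex.normSq_eq_norm_sq, Complex.re_mul_ofReal]
  rw [sesq_apply]
  simp only [Fin.sum_univ_castSucc, h0, zero_mul, Finset.sum_const_zero, zero_add, Complex.add_re,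
    Complex.re_sum, hsymm, hlast]
  ring

theorem neg_le_two_mul_re_mul (hε : 0 < ε) (h x y : ℂ) :
    -(ε * ‖x‖ ^ 2 + ‖h‖ ^ 2 / ε * ‖y‖ ^ 2) ≤ 2 * (h * (x * star y)).re := by
  have hnorm : -(‖h‖ * (‖x‖ * ‖y‖)) ≤ (h * (x * star y)).re := by
    simpa only [norm_mul, norm_star] using
      neg_le_of_abs_le (Complex.abs_re_le_norm (h * (x * star y)))
  have hsq : 0 ≤ (ε * ‖x‖ - ‖h‖ * ‖y‖) ^ 2 / ε := by positivity
  have hexpand : (ε * ‖x‖ - ‖h‖ * ‖y‖) ^ 2 / ε =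
      ε * ‖x‖ ^ 2 + ‖h‖ ^ 2 / ε * ‖y‖ ^ 2 - 2 * (‖h‖ * (‖x‖ * ‖y‖)) := by
    field_simp
    ring
  linarith

theorem sub_le_re_sesq_self_of_block_eq_zero (hH : H.IsHermitian)
    (h0 : ∀ α β : Fin m, H α.castSucc β.castSucc = 0) (hε : 0 < ε)
    (hlast : 1 + (∑ α : Fin m, ‖H α.castSucc (.last m)‖ ^ 2) / ε ≤ (H (.last m) (.last m)).re)
    (x : CSpace (m + 1)) :
    ‖x (.last m)‖ ^ 2 - ε * ∑ i, ‖x i‖ ^ 2 ≤ (sesq H x x).re := by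
  have hcross := Finset.sum_le_sum fun (α : Fin m) (_ : α ∈ Finset.univ) =>
    neg_le_two_mul_re_mul hε (H α.castSucc (.last m)) (x α.castSucc) (x (.last m))
  rw [Finset.sum_neg_distrib, Finset.sum_add_distrib, ← Finset.mul_sum, ← Finset.mul_sum,
    ← Finset.sum_mul, ← Finset.sum_div] at hcross
  have hdiag := mul_le_mul_of_nonneg_right hlast (sq_nonneg ‖x (.last m)‖)
  have hpos : 0 ≤ ε * ‖x (.last m)‖ ^ 2 := by positivity
  rw [re_sesq_self_of_block_eq_zero hH h0, Fin.sum_univ_castSucc]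
  linarith

/-- The reflection `diag(1, …, 1, -1)`. The average of `B` and its conjugate by this reflection
has the entries of `B` in the upper left block and on the diagonal, and zeros elsewhere. -/
def lastReflection (m : ℕ) : Matrix (Fin (m + 1)) (Fin (m + 1)) ℂ :=
  Matrix.diagonal (Fin.snoc 1 (-1))

theorem isHermitian_lastReflection : (lastReflection m).IsHermitian := by
  rw [lastReflection, Matrix.isHermitian_diagonal_iff]
  exact Fin.lastCases (by simp [IsSelfAdjoint]) fun α => by simp [IsSelfAdjoint]

theorem lastReflection_mul_self : lastReflection m * lastReflection m = 1 := by
  rw [lastReflection, Matrix.diagonal_mul_diagonal, ← Matrix.diagonal_one]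
  congr 1
  exact funext (Fin.lastCases (by simp) fun α => by simp)

theorem sub_le_re_sesq_self_of_block_eq (hA : A.IsHermitian) (hB : B.IsHermitian)
    (hAB : ∀ α β : Fin m, A α.castSucc β.castSucc = B α.castSucc β.castSucc) (hε : 0 < ε)
    (hlast : (B (.last m) (.last m)).re + 1 + (∑ α : Fin m, ‖A α.castSucc (.last m)‖ ^ 2) / ε ≤
      (A (.last m) (.last m)).re) (x : CSpace (m + 1)) :
    ‖x (.last m)‖ ^ 2 - ε * ∑ i, ‖x i‖ ^ 2 ≤
      (sesq (A - (2⁻¹ : ℝ) • (B + lastReflection m * B * lastReflection m)) x x).re := by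
  have hB' : (lastReflection m * B * lastReflection m).IsHermitian := by
    have h := isHermitian_mul_mul_conjTranspose (lastReflection m) hB
    rwa [isHermitian_lastReflection.eq] at h
  have hcol (α : Fin m) : (A - (2⁻¹ : ℝ) • (B + lastReflection m * B * lastReflection m))
      α.castSucc (.last m) = A α.castSucc (.last m) := by
    simp [lastReflection]
  have hdiag : (A - (2⁻¹ : ℝ) • (B + lastReflection m * B * lastReflection m))
      (.last m) (.last m) = A (.last m) (.last m) - B (.last m) (.last m) := by
    simp only [lastReflection, Matrix.sub_apply, Matrix.add_apply, Matrix.smul_apply,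
      Complex.real_smul, Complex.ofReal_inv, Complex.ofReal_ofNat, mul_diagonal, diagonal_mul,
      Fin.snoc_last]
    ring
  refine sub_le_re_sesq_self_of_block_eq_zero (hA.sub ((hB.add hB').smul (star_trivial _)))
    (fun α β => ?_) hε ?_ x
  · simp only [lastReflection, Matrix.sub_apply, Matrix.add_apply, Matrix.smul_apply,
      Complex.real_smul, Complex.ofReal_inv, Complex.ofReal_ofNat, mul_diagonal, diagonal_mul,
      Fin.snoc_castSucc, Pi.one_apply, hAB]
    ring
  · simp only [hcol, hdiag, Complex.sub_re]
    linarith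

theorem exists_add_sub_le_eigenvalues {l : Fin (m + 1) → ℝ} (hA : A.IsHermitian)
    (hB : B.IsHermitian)
    (hAB : ∀ α β : Fin m, A α.castSucc β.castSucc = B α.castSucc β.castSucc)
    (hl : HasSpectrum B l) (hε : 0 < ε)
    (hlast : (B (.last m) (.last m)).re + 1 + (∑ α : Fin m, ‖A α.castSucc (.last m)‖ ^ 2) / ε ≤
      (A (.last m) (.last m)).re) :
    ∃ μ ∈ convexHull ℝ (range fun σ : Equiv.Perm (Fin (m + 1)) => l ∘ σ),
      ∃ d ∈ stdSimplex ℝ (Fin (m + 1)), μ + d - ε • (1 : Fin (m + 1) → ℝ) ≤ hA.eigenvalues := by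
  let S := lastReflection m
  have hl' : HasSpectrum (S * B * S) l := hl.conj lastReflection_mul_self
  have hB' : (S * B * S).IsHermitian := by
    have h := isHermitian_mul_mul_conjTranspose S hB
    rwa [isHermitian_lastReflection.eq] at h
  let Q : Matrix (Fin (m + 1)) (Fin (m + 1)) ℂ := star hA.eigenvectorUnitary
  have hQ : Q ∈ Matrix.unitaryGroup (Fin (m + 1)) ℂ := (star hA.eigenvectorUnitary).2
  have hQQ : Qᴴ * Q = 1 := Matrix.mem_unitaryGroup_iff'.1 hQ
  have hQA : Q * A * Qᴴ = Matrix.diagonal (Complex.ofReal ∘ hA.eigenvalues) :=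
    hA.conjStarAlgAut_star_eigenvectorUnitary
  have hD := norm_sq_mem_doublyStochastic hQ
  refine ⟨(2⁻¹ : ℝ) • (fun i => ((Q * B * Qᴴ) i i).re) +
      (2⁻¹ : ℝ) • (fun i => ((Q * (S * B * S) * Qᴴ) i i).re), ?_,
    fun i => ‖Q i (.last m)‖ ^ 2, ⟨fun i => sq_nonneg _, sum_col_of_mem_doublyStochastic hD _⟩,
    fun i => ?_⟩
  · exact convex_convexHull ℝ _
      ((hl.conj hQQ).re_diag_mem_convexHull (isHermitian_mul_mul_conjTranspose Q hB))
      ((hl'.conj hQQ).re_diag_mem_convexHull (isHermitian_mul_mul_conjTranspose Q hB'))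
      (by norm_num) (by norm_num) (by norm_num)
  · have hrow : ∑ k, ‖Q i k‖ ^ 2 = 1 := sum_row_of_mem_doublyStochastic hD i
    have hlower := sub_le_re_sesq_self_of_block_eq hA hB hAB hε hlast (Q i)
    have hsplit : (sesq (A - (2⁻¹ : ℝ) • (B + S * B * S)) (Q i) (Q i)).re = hA.eigenvalues i -
        (2⁻¹ * ((Q * B * Qᴴ) i i).re + 2⁻¹ * ((Q * (S * B * S) * Qᴴ) i i).re) := by
      rw [← mul_mul_conjTranspose_apply]
      simp [Matrix.mul_sub, Matrix.sub_mul, Matrix.mul_add, Matrix.add_mul, hQA]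
    rw [hsplit, hrow] at hlower
    simp only [Pi.sub_apply, Pi.add_apply, Pi.smul_apply, Pi.one_apply, smul_eq_mul]
    linarith

theorem exists_forall_re_last_le {Γ K : Set (Fin (m + 1) → ℝ)} {f : (Fin (m + 1) → ℝ) → ℝ}
    (hΓ : IsOpen Γ) (hupper : IsUpperSet Γ) (hcont : ContinuousOn f Γ) (hmono : StrictMonoOn f Γ)
    (hquasi : QuasiconcaveOn ℝ Γ f)
    (hsymm : ∀ l ∈ Γ, ∀ σ : Equiv.Perm (Fin (m + 1)), l ∘ σ ∈ Γ ∧ f (l ∘ σ) = f l)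
    (hK : IsCompact K) (hKΓ : K ⊆ Γ) :
    ∃ C : ℝ, 0 < C ∧ ∀ (A B : Matrix (Fin (m + 1)) (Fin (m + 1)) ℂ) (hA : A.IsHermitian),
      B.IsHermitian →
      (∀ α β : Fin m, A α.castSucc β.castSucc = B α.castSucc β.castSucc) →
      ∀ l ∈ K, HasSpectrum B l → (hA.eigenvalues ∈ Γ → f hA.eigenvalues ≤ f l) →
      (A (.last m) (.last m)).re ≤ C * (1 + ∑ α : Fin m, ‖A α.castSucc (.last m)‖ ^ 2) := by
  have hhull : IsCompact (symmHull K) := isCompact_symmHull hK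
  have hmem {l μ : Fin (m + 1) → ℝ} (hl : l ∈ K)
      (hμ : μ ∈ convexHull ℝ (range fun σ : Equiv.Perm (Fin (m + 1)) => l ∘ σ)) :
      μ ∈ symmHull K := mem_biUnion hl hμ
  have hhullΓ : symmHull K ⊆ Γ := iUnion₂_subset fun l hl μ hμ =>
    (mem_and_le_of_mem_convexHull hquasi hsymm (hKΓ hl) hμ).1
  obtain ⟨ε, hε, hlt⟩ := exists_pos_forall_lt_add_sub hΓ hupper hcont hmono hhull hhullΓ
  obtain ⟨R, hR0, hR⟩ := hhull.isBounded.exists_pos_norm_le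
  refine ⟨R + 1 + 1 / ε, by positivity, fun A B hA hB hAB l hl hBl hle => ?_⟩
  have hBR : (B (.last m) (.last m)).re ≤ R :=
    (le_abs_self _).trans ((norm_le_pi_norm (fun i => (B i i).re) _).trans
      (hR _ (hmem hl (hBl.re_diag_mem_convexHull hB))))
  set s := ∑ α : Fin m, ‖A α.castSucc (.last m)‖ ^ 2
  have hs : 0 ≤ s := Finset.sum_nonneg fun α _ => sq_nonneg _
  by_contra! hlarge
  have hexpand : (R + 1 + 1 / ε) * (1 + s) = R + 1 + s / ε + (1 / ε + (R + 1) * s) := by ring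
  have hpos : 0 ≤ 1 / ε + (R + 1) * s := add_nonneg (by positivity) (mul_nonneg (by positivity) hs)
  obtain ⟨μ, hμ, d, hd, hμd⟩ := exists_add_sub_le_eigenvalues hA hB hAB hBl hε (by linarith)
  obtain ⟨hμdΓ, hμlt⟩ := hlt μ (hmem hl hμ) d hd
  have hAΓ : hA.eigenvalues ∈ Γ := hupper hμd hμdΓ
  refine (hle hAΓ).not_gt ?_
  calc f l ≤ f μ := (mem_and_le_of_mem_convexHull hquasi hsymm (hKΓ hl) hμ).2
    _ < f (μ + d - ε • (1 : Fin (m + 1) → ℝ)) := hμlt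
    _ ≤ f hA.eigenvalues := hmono.monotoneOn hμdΓ hAΓ hμd

end LastDiagonalEntry

section AdaptedFrame

open Matrix

variable {m : ℕ} {G A : Matrix (Fin (m + 1)) (Fin (m + 1)) ℂ} {a : Fin m → CSpace (m + 1)}
  {ν : CSpace (m + 1)}

/-- The frame with rows `a₁, …, aₘ, √2 ν`. If `ν` is the unit normal for the real metric, then
`ξₙ = (ν - √-1 Jν)/2` only has length `1/√2`; the factor `√2` normalises it. -/
noncomputable def adaptedFrame (a : Fin m → CSpace (m + 1)) (ν : CSpace (m + 1)) :
    Matrix (Fin (m + 1)) (Fin (m + 1)) ℂ :=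
  Matrix.of (Fin.snoc (α := fun _ => CSpace (m + 1)) a (((√2 : ℝ) : ℂ) • ν))

theorem adaptedFrame_castSucc (α : Fin m) : adaptedFrame a ν α.castSucc = a α :=
  Fin.snoc_castSucc (α := fun _ => CSpace (m + 1)) _ _ α

theorem adaptedFrame_last : adaptedFrame a ν (.last m) = ((√2 : ℝ) : ℂ) • ν :=
  Fin.snoc_last (α := fun _ => CSpace (m + 1)) _ _

theorem adaptedFrame_conj_castSucc_last (α : Fin m) :
    (adaptedFrame a ν * A * (adaptedFrame a ν)ᴴ) α.castSucc (.last m)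
      = (√2 : ℝ) * sesq A (a α) ν := by
  rw [mul_mul_conjTranspose_apply, adaptedFrame_castSucc, adaptedFrame_last, LinearMap.map_smulₛₗ,
    Complex.conj_ofReal, smul_eq_mul]

theorem adaptedFrame_conj_last_last :
    (adaptedFrame a ν * A * (adaptedFrame a ν)ᴴ) (.last m) (.last m) = 2 * sesq A ν ν := by
  rw [mul_mul_conjTranspose_apply, adaptedFrame_last, LinearMap.map_smulₛₗ, map_smul,
    LinearMap.smul_apply, Complex.conj_ofReal, smul_smul, ← Complex.ofReal_mul,
    Real.mul_self_sqrt zero_le_two, Complex.ofReal_ofNat, smul_eq_mul]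

theorem adaptedFrame_conj_eq_one (hG : G.IsHermitian)
    (ha : ∀ α β, sesq G (a α) (a β) = if α = β then 1 else 0) (hνa : ∀ α, sesq G ν (a α) = 0)
    (hν : 2 * sesq G ν ν = 1) : adaptedFrame a ν * G * (adaptedFrame a ν)ᴴ = 1 := by
  have hlast (α : Fin m) :
      (adaptedFrame a ν * G * (adaptedFrame a ν)ᴴ) α.castSucc (.last m) = 0 := by
    rw [adaptedFrame_conj_castSucc_last, ← star_sesq hG, hνa, star_zero, mul_zero]
  ext i j
  refine Fin.lastCases ?_ (fun α => ?_) i <;> refine Fin.lastCases ?_ (fun β => ?_) j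
  · rw [adaptedFrame_conj_last_last, hν, Matrix.one_apply_eq]
  · rw [← (isHermitian_mul_mul_conjTranspose _ hG).apply, hlast, star_zero,
      Matrix.one_apply_ne (Fin.castSucc_lt_last β).ne']
  · rw [hlast, Matrix.one_apply_ne (Fin.castSucc_lt_last α).ne]
  · rw [mul_mul_conjTranspose_apply, adaptedFrame_castSucc, adaptedFrame_castSucc, ha,
      Matrix.one_apply]
    simp only [Fin.castSucc_inj]

theorem exists_forall_re_sesq_le {Γ K : Set (Fin (m + 1) → ℝ)} {f : (Fin (m + 1) → ℝ) → ℝ}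
    (hΓ : IsOpen Γ) (hupper : IsUpperSet Γ) (hcont : ContinuousOn f Γ) (hmono : StrictMonoOn f Γ)
    (hquasi : QuasiconcaveOn ℝ Γ f)
    (hsymm : ∀ l ∈ Γ, ∀ σ : Equiv.Perm (Fin (m + 1)), l ∘ σ ∈ Γ ∧ f (l ∘ σ) = f l)
    (hK : IsCompact K) (hKΓ : K ⊆ Γ) :
    ∃ C : ℝ, 0 < C ∧ ∀ G A B : Matrix (Fin (m + 1)) (Fin (m + 1)) ℂ,
      G.IsHermitian → A.IsHermitian → B.IsHermitian →
      ∀ (a : Fin m → CSpace (m + 1)) (ν : CSpace (m + 1)),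
      (∀ α β, sesq G (a α) (a β) = if α = β then 1 else 0) → (∀ α, sesq G ν (a α) = 0) →
      2 * sesq G ν ν = 1 → (∀ α β, sesq A (a α) (a β) = sesq B (a α) (a β)) →
      ∀ l ∈ K, HasSpectrum (G⁻¹ * B) l → (∀ l' ∈ Γ, HasSpectrum (G⁻¹ * A) l' → f l' ≤ f l) →
      (sesq A ν ν).re ≤ C * (1 + ∑ α, ‖sesq A (a α) ν‖ ^ 2) := by
  obtain ⟨C, hC, hle⟩ := exists_forall_re_last_le hΓ hupper hcont hmono hquasi hsymm hK hKΓ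
  refine ⟨C, hC, fun G A B hG hA hB a ν ha hνa hν hAB l hl hBl hf => ?_⟩
  set P := adaptedFrame a ν with hPdef
  have hP : P * G * Pᴴ = 1 := adaptedFrame_conj_eq_one hG ha hνa hν
  have hPA : (P * A * Pᴴ).IsHermitian := isHermitian_mul_mul_conjTranspose P hA
  have hblock (α β : Fin m) :
      (P * A * Pᴴ) α.castSucc β.castSucc = (P * B * Pᴴ) α.castSucc β.castSucc := by
    simp only [mul_mul_conjTranspose_apply, hPdef, adaptedFrame_castSucc, hAB]
  have hbound := hle _ _ hPA (isHermitian_mul_mul_conjTranspose P hB) hblock l hl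
    ((hasSpectrum_inv_mul_iff hP).1 hBl)
    fun hmem => hf _ hmem ((hasSpectrum_inv_mul_iff hP).2 (hasSpectrum_eigenvalues hPA))
  simp only [hPdef, adaptedFrame_conj_last_last, adaptedFrame_conj_castSucc_last, norm_mul,
    mul_pow, Complex.norm_real, Real.norm_eq_abs, sq_abs, Real.sq_sqrt zero_le_two,
    ← Finset.mul_sum] at hbound
  rw [← Complex.ofReal_ofNat, Complex.re_ofReal_mul] at hbound
  linarith

end AdaptedFrame

namespace ComplexManifoldWithBoundary

variable {n : ℕ} {M : Type*} [TopologicalSpace M] {X : ComplexManifoldWithBoundary n M}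
  {g : X.HermitianMetric} {χ : X.RealOneOneForm} {u v : M → ℝ} {e : PartialEquiv M (CSpace n)}
  {p : M}

theorem isHermitian_deform (hu : X.IsCk 2 u) (he : e ∈ X.atlas) {z : CSpace n}
    (hz : z ∈ e.target) : (χ.deform u e z).IsHermitian := by
  obtain ⟨ρ, hρ⟩ := X.c2_boundary e he z hz
  exact (χ.isHermitian e he z hz).add (isHermitian_complexHessian (hu e he)
    (X.uniqueDiffOn_target he) (hρ.mem_closure_interior hz) hz)

theorem continuousOn_coeff (he : e ∈ X.atlas) : ContinuousOn (χ.coeff e) e.target :=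
  continuousOn_pi.2 fun i => continuousOn_pi.2 fun j => (χ.smooth e he i j).continuousOn

theorem continuousOn_inv_coeff_mul_deform (hu : X.IsCk 2 u) (he : e ∈ X.atlas) :
    ContinuousOn (fun z => (g.coeff e z)⁻¹ * χ.deform u e z) e.target := by
  have hinv : ContinuousOn (fun z => (g.coeff e z)⁻¹) e.target := fun z hz => by
    have hdet : (g.coeff e z).det ≠ 0 := (g.posDef e he z hz).det_pos.ne'
    have hinv := continuousAt_matrix_inv (g.coeff e z)
      (NormedRing.inverse_continuousAt (Units.mk0 _ hdet))
    exact hinv.comp_continuousWithinAt (continuousOn_coeff he z hz)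
  exact hinv.mul ((continuousOn_coeff he).add
    (continuousOn_complexHessian (hu e he) (X.uniqueDiffOn_target he)))

theorem tendsto_of_isEigenvalues {β : Type*} [TopologicalSpace β] {f : (Fin n → ℝ) → β}
    {l : M → Fin n → ℝ} {l₀ : Fin n → ℝ} {F : Filter M} (hF : F ≤ 𝓝 p)
    (hf : ∀ σ : Equiv.Perm (Fin n), Tendsto f (𝓝 (l₀ ∘ σ)) (𝓝 (f l₀))) (hu : X.IsCk 2 u)
    (he : e ∈ X.atlas) (hp : p ∈ e.source) (hl : ∀ᶠ q in F, X.IsEigenvalues g χ u q (l q))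
    (hl₀ : HasSpectrum ((g.coeff e (e p))⁻¹ * χ.deform u e (e p)) l₀) :
    Tendsto (fun q => f (l q)) F (𝓝 (f l₀)) := by
  have hsource : ∀ᶠ q in F, q ∈ e.source := hF ((X.isOpen_source e he).mem_nhds hp)
  have hcoord : Tendsto e F (𝓝[e.target] (e p)) := tendsto_nhdsWithin_iff.2
    ⟨((X.continuousOn_coord e he).continuousAt ((X.isOpen_source e he).mem_nhds hp)).tendsto.comp
      hF, hsource.mono fun q hq => e.map_source hq⟩
  refine tendsto_of_hasSpectrum hf
    ((continuousOn_inv_coeff_mul_deform hu he _ (e.map_source hp)).tendsto.comp hcoord) ?_ hl₀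
  filter_upwards [hl, hsource] with q hq hqe using hq e he hqe

theorem le_of_forall_inner_le {Γ : Set (Fin n → ℝ)} {f : (Fin n → ℝ) → ℝ} (hΓ : IsOpen Γ)
    (hcont : ContinuousOn f Γ)
    (hsymm : ∀ l ∈ Γ, ∀ σ : Equiv.Perm (Fin n), l ∘ σ ∈ Γ ∧ f (l ∘ σ) = f l)
    (hu : X.IsCk 2 u) (hv : X.IsCk 2 v) (hadm : X.IsAdmissible g χ Γ u)
    (hadm' : X.IsAdmissible g χ Γ v)
    (hle : ∀ q ∈ X.inner, ∀ l ∈ Γ, ∀ l' ∈ Γ, X.IsEigenvalues g χ u q l →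
      X.IsEigenvalues g χ v q l' → f l ≤ f l')
    (he : e ∈ X.atlas) (hp : p ∈ e.source) {l l' : Fin n → ℝ} (hl : l ∈ Γ) (hl' : l' ∈ Γ)
    (hul : HasSpectrum ((g.coeff e (e p))⁻¹ * χ.deform u e (e p)) l)
    (hvl : HasSpectrum ((g.coeff e (e p))⁻¹ * χ.deform v e (e p)) l') : f l ≤ f l' := by
  have hf (l : Fin n → ℝ) (hl : l ∈ Γ) (σ : Equiv.Perm (Fin n)) :
      Tendsto f (𝓝 (l ∘ σ)) (𝓝 (f l)) := by
    rw [← (hsymm l hl σ).2]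
    exact (hcont.continuousAt (hΓ.mem_nhds (hsymm l hl σ).1)).tendsto
  have : (𝓝[X.inner] p).NeBot := mem_closure_iff_nhdsWithin_neBot.1 (X.mem_closure_inner p)
  have hinner : ∀ᶠ q in 𝓝[X.inner] p, q ∈ X.inner := self_mem_nhdsWithin
  obtain ⟨L, hL⟩ := (hinner.mono hadm).choice
  obtain ⟨L', hL'⟩ := (hinner.mono hadm').choice
  refine le_of_tendsto_of_tendsto
    (tendsto_of_isEigenvalues nhdsWithin_le_nhds (hf l hl) hu he hp (hL.mono fun q hq => hq.2) hul)
    (tendsto_of_isEigenvalues nhdsWithin_le_nhds (hf l' hl') hv he hp (hL'.mono fun q hq => hq.2)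
      hvl) ?_
  filter_upwards [hinner, hL, hL'] with q hq hLq hL'q
  exact hle q hq _ hLq.1 _ hL'q.1 hLq.2 hL'q.2

theorem complexTangentSpace_le (he : e ∈ X.atlas) (hp : p ∈ X.boundary) (hpe : p ∈ e.source)
    {ρ₁ ρ₂ : CSpace n → ℝ} (h₁ : IsLocalDefiningFunction e.target (e p) ρ₁)
    (h₂ : IsLocalDefiningFunction e.target (e p) ρ₂) :
    complexTangentSpace ρ₁ (e p) ≤ complexTangentSpace ρ₂ (e p) := fun a ha => by
  have hz : e p ∈ e.target := e.map_source hpe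
  have hzi := (X.mem_boundary_iff he hpe).1 hp
  rw [mem_complexTangentSpace] at ha ⊢
  exact ⟨h₁.fderiv_eq_zero_of_fderiv_eq_zero h₂ hz hzi ha.1,
    h₁.fderiv_eq_zero_of_fderiv_eq_zero h₂ hz hzi ha.2⟩

theorem InComplexTangent.mem_complexTangentSpace {a : CSpace n}
    (ha : X.InComplexTangent e p (a, 0)) (he : e ∈ X.atlas) (hp : p ∈ X.boundary)
    (hpe : p ∈ e.source) {ρ : CSpace n → ℝ} (hρ : IsLocalDefiningFunction e.target (e p) ρ) :
    a ∈ complexTangentSpace ρ (e p) := by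
  obtain ⟨ρ', hρ', hd, -⟩ := ha
  exact complexTangentSpace_le he hp hpe hρ' hρ (dC_mk_zero_eq_zero_iff.1 hd)

theorem IsLeviFlat.sesq_deform_eq (hX : X.IsLeviFlat) (hu : X.IsCk 2 u) (hv : X.IsCk 2 v)
    (huv : ∀ q ∈ X.boundary, u q = v q) (he : e ∈ X.atlas) (hp : p ∈ X.boundary)
    (hpe : p ∈ e.source) {a b : CSpace n} (ha : X.InComplexTangent e p (a, 0))
    (hb : X.InComplexTangent e p (b, 0)) :
    sesq (χ.deform u e (e p)) a b = sesq (χ.deform v e (e p)) a b := by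
  have hz : e p ∈ e.target := e.map_source hpe
  have hzi := (X.mem_boundary_iff he hpe).1 hp
  have hS := X.uniqueDiffOn_target he
  obtain ⟨ρ, hρ, hlevi⟩ := hX p hp e he hpe
  have hvan : ∀ w ∈ e.target, w ∉ interior e.target → (u ∘ e.symm - v ∘ e.symm) w = 0 := by
    intro w hw hwi
    have hwb : e.symm w ∈ X.boundary := by
      rwa [X.mem_boundary_iff he (e.map_target hw), e.right_inv hw]
    exact sub_eq_zero.2 (huv _ hwb)
  have hlevi' : ∀ c ∈ complexTangentSpace ρ (e p),
      sesq (complexHessian ρ univ (e p)) c c = 0 := fun c hc => by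
    rw [← form_mk_zero]
    exact hlevi (c, 0) (J_mk_zero c) (dC_mk_zero_eq_zero_iff.2 hc)
  have hzero := sesq_complexHessian_eq_zero (h := u ∘ e.symm - v ∘ e.symm)
    ((hu e he).sub (hv e he)) hS hρ (hρ.mem_closure_interior hz) hz hzi hvan hlevi'
    (ha.mem_complexTangentSpace he hp hpe hρ) (hb.mem_complexTangentSpace he hp hpe hρ)
  rw [complexHessian_sub (hu e he) (hv e he) hS hz, sesq_sub, LinearMap.sub_apply,
    LinearMap.sub_apply, sub_eq_zero] at hzero
  simp only [RealOneOneForm.deform, sesq_add, LinearMap.add_apply, hzero]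

theorem IsUnitInnerNormal.sesq_eq_zero {ν a : CSpace n} (hν : X.IsUnitInnerNormal g e p ν)
    (he : e ∈ X.atlas) (hp : p ∈ X.boundary) (hpe : p ∈ e.source)
    (ha : X.InComplexTangent e p (a, 0)) : sesq (g.coeff e (e p)) ν a = 0 := by
  obtain ⟨ρ, hρ, -, horth, -⟩ := hν
  obtain ⟨ha1, ha2⟩ := mem_complexTangentSpace.1 (ha.mem_complexTangentSpace he hp hpe hρ)
  have h1 := horth a ha1
  have h2 := horth (Complex.I • a) ha2
  rw [tensor_ofReal] at h1 h2
  rw [LinearMap.map_smulₛₗ, map_smul, LinearMap.smul_apply, Complex.conj_I, smul_eq_mul,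
    smul_eq_mul] at h2
  linear_combination (h1 + Complex.I * h2) / 2 +
    (sesq (g.coeff e (e p)) ν a - sesq (g.coeff e (e p)) a ν) / 2 * Complex.I_mul_I

theorem IsUnitInnerNormal.two_mul_sesq_self {ν : CSpace n} (hν : X.IsUnitInnerNormal g e p ν) :
    2 * sesq (g.coeff e (e p)) ν ν = 1 := by
  obtain ⟨-, -, -, -, hunit⟩ := hν
  rw [two_mul, ← tensor_ofReal, hunit]

end ComplexManifoldWithBoundary

end LeviFlatDirichlet

open LeviFlatDirichlet in
theorem proposition4p1_general {m : ℕ} {Γ K : Set (Fin (m + 1) → ℝ)} {f : (Fin (m + 1) → ℝ) → ℝ}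
    (hΓ : IsOpen Γ) (hupper : IsUpperSet Γ) (hcont : ContinuousOn f Γ) (hmono : StrictMonoOn f Γ)
    (hquasi : QuasiconcaveOn ℝ Γ f)
    (hsymm : ∀ l ∈ Γ, ∀ σ : Equiv.Perm (Fin (m + 1)), l ∘ σ ∈ Γ ∧ f (l ∘ σ) = f l)
    (hK : IsCompact K) (hKΓ : K ⊆ Γ) :
    ∃ C : ℝ, 0 < C ∧ ∀ {M : Type*} [TopologicalSpace M]
      {X : ComplexManifoldWithBoundary (m + 1) M} {g : X.HermitianMetric} {χ : X.RealOneOneForm}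
      {u v : M → ℝ}, X.IsLeviFlat → X.IsCk 2 u → X.IsCk 2 v → (∀ p ∈ X.boundary, u p = v p) →
      X.IsAdmissible g χ Γ u → (∀ p, ∃ l ∈ K, X.IsEigenvalues g χ v p l) →
      (∀ p ∈ X.inner, ∀ l ∈ Γ, ∀ l' ∈ Γ, X.IsEigenvalues g χ u p l →
        X.IsEigenvalues g χ v p l' → f l ≤ f l') →
      ∀ p₀ ∈ X.boundary, ∀ e ∈ X.atlas, p₀ ∈ e.source →
      ∀ ν : CSpace (m + 1), X.IsUnitInnerNormal g e p₀ ν →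
      ∀ ξn : CTangent (m + 1), ξn = (1 / 2 : ℂ) • (ofReal ν - Complex.I • J (ofReal ν)) →
      ∀ ξ : Fin m → CTangent (m + 1), (∀ α, X.InComplexTangent e p₀ (ξ α)) →
        (∀ α, J (ξ α) = Complex.I • ξ α) →
        (∀ α β, g.tensor e (e p₀) (ξ α) (conjVec (ξ β)) = if α = β then 1 else 0) →
        (form (χ.deform u e (e p₀)) ξn (J (conjVec ξn))).re
          ≤ C * (1 + ∑ α, ‖form (χ.deform u e (e p₀)) (ξ α) (J (conjVec ξn))‖ ^ 2) := by
  obtain ⟨C, hC, hbound⟩ := exists_forall_re_sesq_le hΓ hupper hcont hmono hquasi hsymm hK hKΓ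
  refine ⟨C, hC, ?_⟩
  intro M _ X g χ u v hX hu hv huv hadm hvK hle p₀ hp₀ e he hp₀e ν hν ξn hξn ξ hξT hξJ hξg
  obtain ⟨a, rfl⟩ : ∃ a : Fin m → CSpace (m + 1), ξ = fun α => (a α, 0) :=
    ⟨fun α => (ξ α).1, funext fun α => eq_mk_zero_of_J_eq (hξJ α)⟩
  obtain ⟨l, hlK, hl⟩ := hvK p₀
  have hadm' : ComplexManifoldWithBoundary.IsAdmissible _ _ _ Γ _ := fun p _ =>
    (hvK p).imp fun l hl => ⟨hKΓ hl.1, hl.2⟩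
  have hz : e p₀ ∈ e.target := e.map_source hp₀e
  rw [half_smul_ofReal_sub] at hξn
  simp only [tensor_mk_zero] at hξg
  simp only [hξn, form_mk_zero]
  exact hbound _ _ _ (g.isHermitian e he _ hz)
    (ComplexManifoldWithBoundary.isHermitian_deform hu he hz)
    (ComplexManifoldWithBoundary.isHermitian_deform hv he hz) a ν hξg
    (fun α => hν.sesq_eq_zero he hp₀ hp₀e (hξT α)) hν.two_mul_sesq_self
    (fun α β => hX.sesq_deform_eq hu hv huv he hp₀ hp₀e (hξT α) (hξT β)) l hlK (hl e he hp₀e)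
    fun l' hl' hul' => ComplexManifoldWithBoundary.le_of_forall_inner_le hΓ hcont hsymm hu hv hadm
      hadm' hle he hp₀e hl' (hKΓ hlK) hul' (hl e he hp₀e)

/-- The constant `C` is chosen before `ψ`, `φ`, `u` and the subsolution `v`; it depends on `v` only
through a compact set `K ⊆ Γ` which contains the eigenvalues of `𝔤[v]`. -/
theorem proposition4p1 {n : ℕ} (hn : 2 ≤ n) {M : Type*} [TopologicalSpace M] [CompactSpace M]
    [T2Space M] (X : LeviFlatDirichlet.ComplexManifoldWithBoundary n M) (hX : X.IsLeviFlat)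
    (g : X.HermitianMetric) (χ : X.RealOneOneForm)
    (Γ : Set (Fin n → ℝ)) (hΓ : LeviFlatDirichlet.IsSymmetricCone Γ)
    (f : (Fin n → ℝ) → ℝ) (hf : LeviFlatDirichlet.IsStructureFunction Γ f)
    (K : Set (Fin n → ℝ)) (hK : IsCompact K) (hKΓ : K ⊆ Γ) :
    ∃ C : ℝ, 0 < C ∧ ∀ ψ φ v u : M → ℝ,
      Continuous ψ → 0 < LeviFlatDirichlet.delta Γ f ψ →
      X.IsSubsolution g χ Γ f ψ φ v →
      (∀ p, ∃ l ∈ K, X.IsEigenvalues g χ v p l) →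
      X.IsSolution g χ Γ f ψ φ u →
      ∀ p₀ ∈ X.boundary, ∀ e ∈ X.atlas, p₀ ∈ e.source →
      ∀ ν : LeviFlatDirichlet.CSpace n, X.IsUnitInnerNormal g e p₀ ν →
      ∀ ξn : LeviFlatDirichlet.CTangent n,
        ξn = (1 / 2 : ℂ) • (LeviFlatDirichlet.ofReal ν
          - Complex.I • LeviFlatDirichlet.J (LeviFlatDirichlet.ofReal ν)) →
      ∀ ξ : Fin (n - 1) → LeviFlatDirichlet.CTangent n,
        (∀ α, X.InComplexTangent e p₀ (ξ α)) →
        (∀ α, LeviFlatDirichlet.J (ξ α) = Complex.I • ξ α) →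
        (∀ α β, g.tensor e (e p₀) (ξ α) (LeviFlatDirichlet.conjVec (ξ β))
          = if α = β then 1 else 0) →
        (LeviFlatDirichlet.form (χ.deform u e (e p₀)) ξn
            (LeviFlatDirichlet.J (LeviFlatDirichlet.conjVec ξn))).re
          ≤ C * (1 + ∑ α, ‖LeviFlatDirichlet.form (χ.deform u e (e p₀)) (ξ α)
            (LeviFlatDirichlet.J (LeviFlatDirichlet.conjVec ξn))‖ ^ 2) := by
  obtain ⟨m, rfl⟩ : ∃ m, n = m + 1 := ⟨n - 1, by omega⟩
  obtain ⟨C, hC, hbound⟩ := proposition4p1_general hΓ.isOpen hΓ.isUpperSet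
    hf.smooth.continuousOn (hf.strictMonoOn hΓ) hf.concave.quasiconcaveOn
    (fun l hl σ => ⟨hΓ.symmetric l hl σ, hf.symmetric l hl σ⟩) hK hKΓ
  exact ⟨C, hC, fun ψ φ v u _ _ hv hvK hu => hbound hX hu.c2 hv.c2
    (fun p hp => (hu.boundary_value p hp).trans (hv.boundary_value p hp).symm) hu.admissible hvK
    fun p hp l hl l' hl' hul hvl' =>
      (hu.equation p hp l hl hul).trans_le (hv.inequality p hp l' hl' hvl')⟩
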